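/- All manifolds are smooth, connected, Hausdorff, second countable and without boundary. Let $(B,g_B)$ be a compact Riemannian manifold of dimension $m\ge 1$ whose scalar curvature vanishes identically, let $(F,g_F)$ be a pseudo-Riemannian manifold of dimension $k\ge 1$, let $\psi\colon B\to(0,\infty)$ be smooth, and let $\mu,\lambda\in\mathbb{R}$. (No value of $\mu$ is excluded.) The $(\psi,\mu)$-base conformal warped product, or $(\psi,\mu)$-bcwp, is the product manifold $B\times F$ with the pseudo-Riemannian metric $g=\psi^{2\mu}g_B\oplus\psi^{2}g_F$. A pseudo-Riemannian manifold $(N,h)$ is called Einstein with $\rho\in C^\infty(N)$ if $\mathrm{Ric}_h=\rho\,h$. Then the $(\psi,\mu)$-bcwp is Einstein with the constant $\lambda$ if and only if all of the following hold: $(F,g_F)$ is Einstein with $\nu=0$ (that is, $\mathrm{Ric}_{g_F}=0$); $\lambda=0$; $\psi$ is a positive constant; and $(B,g_B)$ is Ricci-flat. -/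

import Mathlib

set_option maxSynthPendingDepth 3

open scoped Manifold ContDiff Topology

noncomputable section

/-! ### Coordinate curvature of a symmetric bilinear form on a vector space

A coordinate representation of a metric is a map `G : E → (E →L[ℝ] E →L[ℝ] ℝ)`, meaningful on an
open subset of the finite-dimensional vector space `E`.  All formulas are the classical ones, written
without choosing a basis of `E`. -/

namespace CoordMetric

variable {E : Type*} [NormedAddCommGroup E] [NormedSpace ℝ E]

/-- Christoffel symbols of the first kind:
`Γ₁(v, w)(z) = ½ (∂_v G(w, z) + ∂_w G(v, z) - ∂_z G(v, w))`. -/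
def christoffelFirst (G : E → (E →L[ℝ] E →L[ℝ] ℝ)) (y : E) : E →L[ℝ] E →L[ℝ] E →L[ℝ] ℝ :=
  let D : E →L[ℝ] E →L[ℝ] E →L[ℝ] ℝ := fderiv ℝ G y
  let flip : (E →L[ℝ] E →L[ℝ] ℝ) →L[ℝ] (E →L[ℝ] E →L[ℝ] ℝ) :=
    (ContinuousLinearMap.flipₗᵢ ℝ E E ℝ).toContinuousLinearEquiv.toContinuousLinearMap
  (1 / 2 : ℝ) • (D + D.flip - flip.comp D.flip)

lemma christoffelFirst_apply (G : E → (E →L[ℝ] E →L[ℝ] ℝ)) (y v w z : E) :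
    christoffelFirst G y v w z =
      1 / 2 * (fderiv ℝ G y v w z + fderiv ℝ G y w v z - fderiv ℝ G y z v w) := by
  simp [christoffelFirst]

/-- Christoffel symbols of the second kind, `G(Γ(v, w), z) = Γ₁(v, w)(z)`; here `(G y).inverse` is the
inverse of the isomorphism `E → E*` given by the nondegenerate form `G y`. -/
def christoffel (G : E → (E →L[ℝ] E →L[ℝ] ℝ)) (y : E) : E →L[ℝ] E →L[ℝ] E :=
  (ContinuousLinearMap.compL ℝ E (E →L[ℝ] ℝ) E (ContinuousLinearMap.inverse (G y))).comp
    (christoffelFirst G y)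

lemma christoffel_apply (G : E → (E →L[ℝ] E →L[ℝ] ℝ)) (y v w : E) :
    christoffel G y v w = ContinuousLinearMap.inverse (G y) (christoffelFirst G y v w) := by
  simp [christoffel]

/-- The curvature endomorphism `x ↦ R(x, v) w = ∇_x ∇_v w - ∇_v ∇_x w` for constant vector
fields `x, v, w`. -/
def curvature (G : E → (E →L[ℝ] E →L[ℝ] ℝ)) (y v w : E) : E →L[ℝ] E :=
  ((fderiv ℝ (christoffel G) y).flip v).flip w - (fderiv ℝ (christoffel G) y v).flip w
    + (christoffel G y).flip (christoffel G y v w)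
    - (christoffel G y v).comp ((christoffel G y).flip w)

lemma curvature_apply (G : E → (E →L[ℝ] E →L[ℝ] ℝ)) (y v w x : E) :
    curvature G y v w x =
      fderiv ℝ (christoffel G) y x v w - fderiv ℝ (christoffel G) y v x w
        + christoffel G y x (christoffel G y v w) - christoffel G y v (christoffel G y x w) := by
  simp [curvature]

/-- The Ricci tensor `Ric(v, w) = tr (x ↦ R(x, v) w)`. -/
def ricci (G : E → (E →L[ℝ] E →L[ℝ] ℝ)) (y : E) : E →ₗ[ℝ] E →ₗ[ℝ] ℝ :=
  LinearMap.mk₂ ℝ (fun v w => LinearMap.trace ℝ E (curvature G y v w : E →ₗ[ℝ] E))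
    (fun v v' w => by
      rw [← map_add]; congr 1; ext x; simp [curvature]; abel)
    (fun a v w => by
      rw [← map_smul]; congr 1; ext x; simp [curvature, smul_sub, smul_add])
    (fun v w w' => by
      rw [← map_add]; congr 1; ext x; simp [curvature]; abel)
    (fun a v w => by
      rw [← map_smul]; congr 1; ext x; simp [curvature, smul_sub, smul_add])

/-- The scalar curvature, i.e. the trace of the Ricci tensor with respect to `G`. -/
def scalarCurvature [FiniteDimensional ℝ E] (G : E → (E →L[ℝ] E →L[ℝ] ℝ)) (y : E) : ℝ :=
  LinearMap.trace ℝ E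
    ((ContinuousLinearMap.inverse (G y) : (E →L[ℝ] ℝ) →ₗ[ℝ] E) ∘ₗ
      (LinearMap.toContinuousLinearMap : (E →ₗ[ℝ] ℝ) ≃ₗ[ℝ] (E →L[ℝ] ℝ)).toLinearMap ∘ₗ ricci G y)

end CoordMetric

section Manifold

variable {E : Type*} [NormedAddCommGroup E] [NormedSpace ℝ E]
  {H : Type*} [TopologicalSpace H] {I : ModelWithCorners ℝ E H}
  {M : Type*} [TopologicalSpace M] [ChartedSpace H M]

/-- The pullback to the model vector space `E`, under the inverse of the chart `e`, of a field `g` of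
bilinear forms on the tangent spaces of `M` (`M` without boundary).  It is meaningful on the target of
the chart. -/
def coordExpression (I : ModelWithCorners ℝ E H)
    (g : ∀ x : M, TangentSpace I x →L[ℝ] TangentSpace I x →L[ℝ] ℝ)
    (e : OpenPartialHomeomorph M H) (y : E) : E →L[ℝ] E →L[ℝ] ℝ :=
  let G : E →L[ℝ] E →L[ℝ] ℝ := g ((e.extend I).symm y)
  let D : E →L[ℝ] E := mfderiv 𝓘(ℝ, E) I (e.extend I).symm y
  G.bilinearComp D D

lemma coordExpression_apply (g : ∀ x : M, TangentSpace I x →L[ℝ] TangentSpace I x →L[ℝ] ℝ)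
    (e : OpenPartialHomeomorph M H) (y v w : E) :
    coordExpression I g e y v w = g ((e.extend I).symm y)
      (mfderiv 𝓘(ℝ, E) I (e.extend I).symm y v) (mfderiv 𝓘(ℝ, E) I (e.extend I).symm y w) := rfl

variable (I M) in
/-- A (smooth) pseudo-Riemannian metric on a manifold without boundary: a field of nondegenerate
symmetric bilinear forms on the tangent spaces whose expression in every chart of the atlas is
smooth. -/
structure PseudoRiemannianMetric where
  /-- the bilinear form on the tangent space at `x` -/
  val (x : M) : TangentSpace I x →L[ℝ] TangentSpace I x →L[ℝ] ℝ
  symm (x : M) (v w : TangentSpace I x) : val x v w = val x w v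
  nondegenerate (x : M) (v : TangentSpace I x) (h : ∀ w, val x v w = 0) : v = 0
  smooth (e : OpenPartialHomeomorph M H) (he : e ∈ atlas H M) :
    ContDiffOn ℝ ∞ (coordExpression I val e) (e.extend I).target

namespace PseudoRiemannianMetric

/-- The metric is Riemannian, i.e. positive definite. -/
def IsRiemannian (g : PseudoRiemannianMetric I M) : Prop :=
  ∀ (x : M) (v : TangentSpace I x), v ≠ 0 → 0 < g.val x v v

/-- `(M, g)` is Einstein with `lam ∈ C^∞(M)`: `Ric_g = lam g`, in every chart of the atlas. -/
def IsEinstein (g : PseudoRiemannianMetric I M) (lam : M → ℝ) : Prop :=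
  ContMDiff I 𝓘(ℝ) ∞ lam ∧
    ∀ e ∈ atlas H M, ∀ y ∈ (e.extend I).target, ∀ v w : E,
      CoordMetric.ricci (coordExpression I g.val e) y v w =
        lam ((e.extend I).symm y) * coordExpression I g.val e y v w

/-- `(M, g)` is Ricci-flat: the Ricci tensor vanishes, in every chart of the atlas. -/
def IsRicciFlat (g : PseudoRiemannianMetric I M) : Prop :=
  ∀ e ∈ atlas H M, ∀ y ∈ (e.extend I).target, ∀ v w : E,
    CoordMetric.ricci (coordExpression I g.val e) y v w = 0

/-- `(M, g)` is scalar-flat: the scalar curvature vanishes, in every chart of the atlas. -/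
def IsScalarFlat [FiniteDimensional ℝ E] (g : PseudoRiemannianMetric I M) : Prop :=
  ∀ e ∈ atlas H M, ∀ y ∈ (e.extend I).target,
    CoordMetric.scalarCurvature (coordExpression I g.val e) y = 0

end PseudoRiemannianMetric

/-! ### Base conformal warped products -/

variable {E' : Type*} [NormedAddCommGroup E'] [NormedSpace ℝ E']
  {H' : Type*} [TopologicalSpace H'] {J : ModelWithCorners ℝ E' H'}
  {N : Type*} [TopologicalSpace N] [ChartedSpace H' N]

/-- The field of bilinear forms `c² g_B ⊕ w² g_F` on the product manifold; the tangent space of the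
product at `(b, f)` is the product of the tangent spaces. -/
def bcwpForm (gB : PseudoRiemannianMetric I M) (gF : PseudoRiemannianMetric J N) (c w : M → ℝ)
    (p : M × N) :
    TangentSpace (I.prod J) p →L[ℝ] TangentSpace (I.prod J) p →L[ℝ] ℝ :=
  let GB : E →L[ℝ] E →L[ℝ] ℝ := gB.val p.1
  let GF : E' →L[ℝ] E' →L[ℝ] ℝ := gF.val p.2
  ((c p.1 ^ 2) • GB.bilinearComp (ContinuousLinearMap.fst ℝ E E') (ContinuousLinearMap.fst ℝ E E')
    + (w p.1 ^ 2) • GF.bilinearComp (ContinuousLinearMap.snd ℝ E E')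
        (ContinuousLinearMap.snd ℝ E E') : E × E' →L[ℝ] E × E' →L[ℝ] ℝ)

lemma bcwpForm_apply (gB : PseudoRiemannianMetric I M) (gF : PseudoRiemannianMetric J N)
    (c w : M → ℝ) (p : M × N) (v v' : E × E') :
    bcwpForm gB gF c w p v v' =
      c p.1 ^ 2 * gB.val p.1 v.1 v'.1 + w p.1 ^ 2 * gF.val p.2 v.2 v'.2 := rfl

lemma mdifferentiableAt_extend_symm [I.Boundaryless] [IsManifold I ∞ M]
    {e : OpenPartialHomeomorph M H} (he : e ∈ atlas H M) {y : E} (hy : y ∈ (e.extend I).target) :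
    MDifferentiableAt 𝓘(ℝ, E) I (e.extend I).symm y := by
  have h := contMDiffOn_extend_symm (I := I) (n := ∞) (IsManifold.subset_maximalAtlas he)
  rw [← e.extend_target'] at h
  exact (h.contMDiffAt (e.isOpen_extend_target.mem_nhds hy)).mdifferentiableAt (by simp)

lemma mfderiv_extend_prod_symm [I.Boundaryless] [J.Boundaryless] [IsManifold I ∞ M]
    [IsManifold J ∞ N] {e : OpenPartialHomeomorph M H} {e' : OpenPartialHomeomorph N H'}
    (he : e ∈ atlas H M) (he' : e' ∈ atlas H' N) {y : E × E'}
    (hy : y ∈ (e.extend I).target ×ˢ (e'.extend J).target) :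
    (mfderiv 𝓘(ℝ, E × E') (I.prod J) ((e.prod e').extend (I.prod J)).symm y : E × E' →L[ℝ] E × E') =
      (mfderiv 𝓘(ℝ, E) I (e.extend I).symm y.1 : E →L[ℝ] E).prodMap
        (mfderiv 𝓘(ℝ, E') J (e'.extend J).symm y.2 : E' →L[ℝ] E') := by
  have h := mfderiv_prodMap (mdifferentiableAt_extend_symm he hy.1)
    (mdifferentiableAt_extend_symm he' hy.2)
  rw [e.extend_prod e']
  have hc : chartedSpaceSelf (E × E') = prodChartedSpace E E E' E' := chartedSpaceSelf_prod.symm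
  rw [modelWithCornersSelf_prod]
  erw [hc]
  exact h

lemma coordExpression_bcwpForm [I.Boundaryless] [J.Boundaryless] [IsManifold I ∞ M]
    [IsManifold J ∞ N] (gB : PseudoRiemannianMetric I M) (gF : PseudoRiemannianMetric J N)
    (c w : M → ℝ) {e : OpenPartialHomeomorph M H} {e' : OpenPartialHomeomorph N H'}
    (he : e ∈ atlas H M) (he' : e' ∈ atlas H' N) {y : E × E'}
    (hy : y ∈ (e.extend I).target ×ˢ (e'.extend J).target) :
    coordExpression (I.prod J) (bcwpForm gB gF c w) (e.prod e') y =
      (c ((e.extend I).symm y.1) ^ 2) • (coordExpression I gB.val e y.1).bilinearComp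
          (ContinuousLinearMap.fst ℝ E E') (ContinuousLinearMap.fst ℝ E E')
      + (w ((e.extend I).symm y.1) ^ 2) • (coordExpression J gF.val e' y.2).bilinearComp
          (ContinuousLinearMap.snd ℝ E E') (ContinuousLinearMap.snd ℝ E E') := by
  have hD := mfderiv_extend_prod_symm he he' hy
  refine ContinuousLinearMap.ext fun v => ContinuousLinearMap.ext fun v' => ?_
  change bcwpForm gB gF c w (((e.prod e').extend (I.prod J)).symm y)
    ((mfderiv 𝓘(ℝ, E × E') (I.prod J) ((e.prod e').extend (I.prod J)).symm y :
      E × E' →L[ℝ] E × E') v)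
    ((mfderiv 𝓘(ℝ, E × E') (I.prod J) ((e.prod e').extend (I.prod J)).symm y :
      E × E' →L[ℝ] E × E') v') = _
  rw [hD]
  rfl

lemma contDiffOn_bilinearComp {V W : Type*} [NormedAddCommGroup V] [NormedSpace ℝ V]
    [NormedAddCommGroup W] [NormedSpace ℝ W] (L : W →L[ℝ] V) {G : V → (V →L[ℝ] V →L[ℝ] ℝ)}
    {s : Set V} (hG : ContDiffOn ℝ ∞ G s) :
    ContDiffOn ℝ ∞ (fun y => (G (L y)).bilinearComp L L) (L ⁻¹' s) := by
  have h1 : ContDiffOn ℝ ∞ (fun y => G (L y)) (L ⁻¹' s) :=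
    hG.comp L.contDiff.contDiffOn fun y hy => hy
  have hf1 := (ContinuousLinearMap.flipₗᵢ ℝ W V ℝ).contDiff (n := ∞)
  have hf2 := (ContinuousLinearMap.flipₗᵢ ℝ W W ℝ).contDiff (n := ∞)
  have h2 := hf1.comp_contDiffOn (h1.clm_comp (contDiffOn_const (c := L)))
  exact hf2.comp_contDiffOn (h2.clm_comp (contDiffOn_const (c := L)))

lemma contDiffOn_coordExpression_bcwpForm [I.Boundaryless] [J.Boundaryless] [IsManifold I ∞ M]
    [IsManifold J ∞ N] (gB : PseudoRiemannianMetric I M) (gF : PseudoRiemannianMetric J N)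
    {c w : M → ℝ} (hc : ContMDiff I 𝓘(ℝ) ∞ c) (hw : ContMDiff I 𝓘(ℝ) ∞ w)
    {e : OpenPartialHomeomorph M H} {e' : OpenPartialHomeomorph N H'}
    (he : e ∈ atlas H M) (he' : e' ∈ atlas H' N) :
    ContDiffOn ℝ ∞ (coordExpression (I.prod J) (bcwpForm gB gF c w) (e.prod e'))
      ((e.prod e').extend (I.prod J)).target := by
  have ht : ((e.prod e').extend (I.prod J)).target
      = (e.extend I).target ×ˢ (e'.extend J).target := by
    rw [e.extend_prod e']; rfl
  rw [ht]
  refine ContDiffOn.congr ?_ fun y hy => coordExpression_bcwpForm gB gF c w he he' hy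
  have key : ∀ f : M → ℝ, ContMDiff I 𝓘(ℝ) ∞ f →
      ContDiffOn ℝ ∞ (fun y : E × E' => f ((e.extend I).symm y.1))
        ((e.extend I).target ×ˢ (e'.extend J).target) := by
    intro f hf
    have h := contMDiffOn_extend_symm (I := I) (n := ∞) (IsManifold.subset_maximalAtlas he)
    rw [← e.extend_target'] at h
    exact (contMDiffOn_iff_contDiffOn.1 (hf.comp_contMDiffOn h)).comp contDiff_fst.contDiffOn
      fun y hy => hy.1
  have hB := (contDiffOn_bilinearComp (ContinuousLinearMap.fst ℝ E E') (gB.smooth e he)).mono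
    (t := (e.extend I).target ×ˢ (e'.extend J).target) fun y hy => hy.1
  have hF := (contDiffOn_bilinearComp (ContinuousLinearMap.snd ℝ E E') (gF.smooth e' he')).mono
    (t := (e.extend I).target ×ˢ (e'.extend J).target) fun y hy => hy.2
  exact (((key c hc).pow 2).smul hB).add (((key w hw).pow 2).smul hF)

/-- The base conformal warped product `c² g_B ⊕ w² g_F` of `(B, g_B)` and `(F, g_F)`, with conformal
factor `c` and warping function `w`. -/
def baseConformalWarpedProduct [I.Boundaryless] [J.Boundaryless] [IsManifold I ∞ M]
    [IsManifold J ∞ N] (gB : PseudoRiemannianMetric I M) (gF : PseudoRiemannianMetric J N)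
    (c w : M → ℝ) (hc : ContMDiff I 𝓘(ℝ) ∞ c) (hc0 : ∀ b, 0 < c b)
    (hw : ContMDiff I 𝓘(ℝ) ∞ w) (hw0 : ∀ b, 0 < w b) :
    PseudoRiemannianMetric (I.prod J) (M × N) where
  val := bcwpForm gB gF c w
  symm p v v' := by
    refine (bcwpForm_apply gB gF c w p v v').trans (Eq.trans ?_ (bcwpForm_apply gB gF c w p v' v).symm)
    exact congrArg₂ (fun a b => c p.1 ^ 2 * a + w p.1 ^ 2 * b) (gB.symm p.1 v.1 v'.1)
      (gF.symm p.2 v.2 v'.2)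
  nondegenerate p v h := by
    refine Prod.ext (gB.nondegenerate p.1 v.1 fun z => ?_) (gF.nondegenerate p.2 v.2 fun z => ?_)
    · have h1 := (bcwpForm_apply gB gF c w p v (z, 0)).symm.trans (h ((z, 0) : E × E'))
      have h2 : gF.val p.2 v.2 (0 : E') = 0 := map_zero (gF.val p.2 v.2)
      have h3 : c p.1 ^ 2 * gB.val p.1 v.1 z = 0 := by simpa [h2] using h1
      exact (mul_eq_zero.1 h3).resolve_left (pow_ne_zero _ (hc0 _).ne')
    · have h1 := (bcwpForm_apply gB gF c w p v (0, z)).symm.trans (h ((0, z) : E × E'))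
      have h2 : gB.val p.1 v.1 (0 : E) = 0 := map_zero (gB.val p.1 v.1)
      have h3 : w p.1 ^ 2 * gF.val p.2 v.2 z = 0 := by simpa [h2] using h1
      exact (mul_eq_zero.1 h3).resolve_left (pow_ne_zero _ (hw0 _).ne')
  smooth := by
    rintro e ⟨e₁, he₁, e₂, he₂, rfl⟩
    exact contDiffOn_coordExpression_bcwpForm gB gF hc hw he₁ he₂

lemma contMDiff_rpow_of_pos {ψ : M → ℝ} (hψ : ContMDiff I 𝓘(ℝ) ∞ ψ) (hψ0 : ∀ b, 0 < ψ b)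
    (μ : ℝ) : ContMDiff I 𝓘(ℝ) ∞ fun b => ψ b ^ μ := fun b =>
  ContDiffAt.comp_contMDiffAt (g := fun t : ℝ => t ^ μ)
    (Real.contDiffAt_rpow_const_of_ne (hψ0 b).ne') (hψ b)

/-- The `(ψ, μ)`-bcwp: the product manifold with the metric `ψ^{2μ} g_B ⊕ ψ² g_F`, i.e. the base
conformal warped product with conformal factor `ψ^μ` and warping function `ψ`. -/
def specialBcwp [I.Boundaryless] [J.Boundaryless] [IsManifold I ∞ M]
    [IsManifold J ∞ N] (gB : PseudoRiemannianMetric I M) (gF : PseudoRiemannianMetric J N)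
    (ψ : M → ℝ) (hψ : ContMDiff I 𝓘(ℝ) ∞ ψ) (hψ0 : ∀ b, 0 < ψ b) (μ : ℝ) :
    PseudoRiemannianMetric (I.prod J) (M × N) :=
  baseConformalWarpedProduct gB gF (fun b => ψ b ^ μ) ψ (contMDiff_rpow_of_pos hψ hψ0 μ)
    (fun b => Real.rpow_pos_of_pos (hψ0 b) μ) hψ hψ0

end Manifold

end

/-! Write ψ = e^u, so that the metric is e^{2μu} g_B ⊕ e^{2u} g_F, with m = dim B, k = dim F and γ =
k + (m - 2)μ. Only two pieces of the Einstein equation are needed to force rigidity.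

Fibre directions (`ricci_bcwp_fiber`): at a fixed point of F, pairing with two vectors on which g_F
does not vanish produces a number ν, independent of the point of B, with ν = λ e^{2u} + e^{2(1-μ)u}
(Δu + γ|∇u|²) on all of B.

Base directions at a critical point of u (`ricci_bcwp_base`): tracing with g_B and using scalar
flatness gives (2(m-1)μ + k) Δu = -mλ e^{2μu} (`laplacian_eq_of_ricci_bcwp_base`). By compactness u
has a maximum, where Δu ≤ 0, and a minimum, where Δu ≥ 0. Multiplying the two identities, the left
side is a square times a nonpositive number, while the right side is (mλ)² times a positive number.
Hence λ = 0, whatever the sign of 2(m-1)μ + k and even if it vanishes, so no μ needs to be excluded.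

With λ = 0 the fibre equation at the two extrema gives ν ≤ 0 and ν ≥ 0, so Δu + γ|∇u|² = 0
everywhere. Hopf's strong maximum principle (`eventually_eq_of_subsolution`) and connectedness make
u constant. For constant u the Ricci tensor is the sum of those of the factors, which settles
Ricci-flatness of both factors and the converse. -/

noncomputable section

/-! ### Levi-Civita calculus of a coordinate metric. -/

namespace CoordMetric

variable {E : Type*} [NormedAddCommGroup E] [NormedSpace ℝ E]

/-- `G` is a smooth pseudo-Riemannian metric on the open subset `s` of the vector space `E`. -/
structure IsMetricOn (G : E → (E →L[ℝ] E →L[ℝ] ℝ)) (s : Set E) : Prop where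
  isOpen : IsOpen s
  contDiffOn : ContDiffOn ℝ ∞ G s
  symm : ∀ y ∈ s, ∀ v w, G y v w = G y w v
  nondegenerate : ∀ y ∈ s, ∀ v, (∀ w, G y v w = 0) → v = 0

/-- Injectivity between spaces of equal dimension. Without invertibility
`ContinuousLinearMap.inverse` takes its default value 0, and the Christoffel symbols would lose
their meaning. -/
lemma isInvertible_of_nondegenerate [FiniteDimensional ℝ E] (G : E →L[ℝ] E →L[ℝ] ℝ)
    (h : ∀ v, (∀ w, G v w = 0) → v = 0) : G.IsInvertible := by
  have hinj : Function.Injective (G : E →ₗ[ℝ] (E →L[ℝ] ℝ)) := by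
    rw [injective_iff_map_eq_zero]
    intro v hv
    exact h v fun w => by
      have : G v = 0 := hv
      simp [this]
  have hrank : Module.finrank ℝ E = Module.finrank ℝ (E →L[ℝ] ℝ) := by
    rw [← (LinearMap.toContinuousLinearMap : (E →ₗ[ℝ] ℝ) ≃ₗ[ℝ] (E →L[ℝ] ℝ)).finrank_eq]
    exact (Subspace.dual_finrank_eq (K := ℝ) (V := E)).symm
  exact ⟨(LinearEquiv.ofInjectiveOfFinrankEq (G : E →ₗ[ℝ] (E →L[ℝ] ℝ)) hinj
    hrank).toContinuousLinearEquiv, ContinuousLinearMap.ext fun v => rfl⟩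

lemma christoffel_congr {G G' : E → (E →L[ℝ] E →L[ℝ] ℝ)} {y : E} (h : G =ᶠ[𝓝 y] G') :
    christoffel G y = christoffel G' y := by
  simp only [christoffel, christoffelFirst, h.fderiv_eq, h.eq_of_nhds]

lemma christoffel_eventuallyEq {G G' : E → (E →L[ℝ] E →L[ℝ] ℝ)} {y : E} (h : G =ᶠ[𝓝 y] G') :
    christoffel G =ᶠ[𝓝 y] christoffel G' :=
  h.eventuallyEq_nhds.mono fun _ hz => christoffel_congr hz

lemma curvature_congr {G G' : E → (E →L[ℝ] E →L[ℝ] ℝ)} {y : E} (h : G =ᶠ[𝓝 y] G') :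
    curvature G y = curvature G' y := by
  funext v w
  simp only [curvature, (christoffel_eventuallyEq h).fderiv_eq, christoffel_congr h]

lemma ricci_apply (G : E → (E →L[ℝ] E →L[ℝ] ℝ)) (y v w : E) :
    ricci G y v w = LinearMap.trace ℝ E (curvature G y v w : E →ₗ[ℝ] E) := rfl

/-- Only the germ of the metric matters. This transfers formulas for an explicit metric to a chart
expression known to agree with it only on the chart target. -/
lemma ricci_congr {G G' : E → (E →L[ℝ] E →L[ℝ] ℝ)} {y : E} (h : G =ᶠ[𝓝 y] G') :
    ricci G y = ricci G' y := by
  ext v w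
  simp only [ricci_apply, curvature_congr h]

namespace IsMetricOn

variable {G : E → (E →L[ℝ] E →L[ℝ] ℝ)} {s : Set E} {y : E}

lemma contDiffAt (h : IsMetricOn G s) (hy : y ∈ s) : ContDiffAt ℝ ∞ G y :=
  h.contDiffOn.contDiffAt (h.isOpen.mem_nhds hy)

lemma eventually_mem (h : IsMetricOn G s) (hy : y ∈ s) : ∀ᶠ z in 𝓝 y, z ∈ s :=
  h.isOpen.mem_nhds hy

lemma hasFDerivAt_apply (h : IsMetricOn G s) (hy : y ∈ s) (a b : E) :
    HasFDerivAt (fun z => G z a b) (((fderiv ℝ G y).flip a).flip b) y := by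
  have hd := ((h.contDiffAt hy).differentiableAt (by simp)).hasFDerivAt
  have h1 := (hd.clm_apply (hasFDerivAt_const a y)).clm_apply (hasFDerivAt_const b y)
  refine h1.congr_fderiv ?_
  ext z; simp

lemma fderiv_symm (h : IsMetricOn G s) (hy : y ∈ s) (x v w : E) :
    fderiv ℝ G y x v w = fderiv ℝ G y x w v := by
  have he : (fun z => G z v w) =ᶠ[𝓝 y] fun z => G z w v :=
    (h.eventually_mem hy).mono fun z hz => h.symm z hz v w
  have := ((h.hasFDerivAt_apply hy w v).congr_of_eventuallyEq he).unique
    (h.hasFDerivAt_apply hy v w)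
  simpa using (DFunLike.congr_fun this x).symm

lemma contDiffAt_fderiv (h : IsMetricOn G s) (hy : y ∈ s) : ContDiffAt ℝ ∞ (fderiv ℝ G) y :=
  (h.contDiffAt hy).fderiv_right (by simp)

lemma contDiffAt_christoffelFirst (h : IsMetricOn G s) (hy : y ∈ s) :
    ContDiffAt ℝ ∞ (christoffelFirst G) y := by
  have hf := h.contDiffAt_fderiv hy
  have hflip : ContDiffAt ℝ ∞ (fun z => (fderiv ℝ G z).flip) y :=
    (ContinuousLinearMap.flipₗᵢ ℝ E E (E →L[ℝ] ℝ)).contDiff.contDiffAt.comp y hf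
  exact (contDiffAt_const (c := (1 / 2 : ℝ))).smul
    ((hf.add hflip).sub (contDiffAt_const.clm_comp hflip))

variable [FiniteDimensional ℝ E]

lemma isInvertible (h : IsMetricOn G s) (hy : y ∈ s) : (G y).IsInvertible :=
  isInvertible_of_nondegenerate _ (h.nondegenerate y hy)

lemma apply_inverse (h : IsMetricOn G s) (hy : y ∈ s) (ξ : E →L[ℝ] ℝ) :
    G y (ContinuousLinearMap.inverse (G y) ξ) = ξ := (h.isInvertible hy).self_apply_inverse ξ

lemma inverse_apply (h : IsMetricOn G s) (hy : y ∈ s) (v : E) :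
    ContinuousLinearMap.inverse (G y) (G y v) = v := (h.isInvertible hy).inverse_apply_self v

lemma contDiffAt_inverse (h : IsMetricOn G s) (hy : y ∈ s) :
    ContDiffAt ℝ ∞ (fun z => ContinuousLinearMap.inverse (G z)) y :=
  (h.isInvertible hy).contDiffAt_map_inverse.comp y (h.contDiffAt hy)

lemma contDiffAt_christoffel (h : IsMetricOn G s) (hy : y ∈ s) :
    ContDiffAt ℝ ∞ (christoffel G) y :=
  ((ContinuousLinearMap.compL ℝ E (E →L[ℝ] ℝ) E).contDiff.contDiffAt.comp y
    (h.contDiffAt_inverse hy)).clm_comp (h.contDiffAt_christoffelFirst hy)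

lemma apply_christoffel (h : IsMetricOn G s) (hy : y ∈ s) (v w z : E) :
    G y (christoffel G y v w) z =
      1 / 2 * (fderiv ℝ G y v w z + fderiv ℝ G y w v z - fderiv ℝ G y z v w) := by
  rw [christoffel_apply, h.apply_inverse hy, christoffelFirst_apply]

/-- Nondegeneracy makes the Koszul identity a characterisation, so a closed form for Christoffel
symbols can be guessed and then checked. -/
lemma christoffel_eq_of (h : IsMetricOn G s) (hy : y ∈ s) {v w a : E}
    (ha : ∀ z, G y a z =
      1 / 2 * (fderiv ℝ G y v w z + fderiv ℝ G y w v z - fderiv ℝ G y z v w)) :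
    christoffel G y v w = a := by
  have : christoffelFirst G y v w = G y a := by
    ext z; rw [ha, christoffelFirst_apply]
  rw [christoffel_apply, this, h.inverse_apply hy]

/-- The Levi-Civita connection is compatible with the metric. -/
lemma fderiv_eq_christoffel (h : IsMetricOn G s) (hy : y ∈ s) (x v w : E) :
    fderiv ℝ G y x v w = G y (christoffel G y x v) w + G y v (christoffel G y x w) := by
  rw [h.symm y hy v, h.apply_christoffel hy, h.apply_christoffel hy, h.fderiv_symm hy x v w]
  ring

lemma hasFDerivAt_christoffel_apply (h : IsMetricOn G s) (hy : y ∈ s) (a b : E) :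
    HasFDerivAt (fun z => christoffel G z a b)
      (((fderiv ℝ (christoffel G) y).flip a).flip b) y := by
  have hd := ((h.contDiffAt_christoffel hy).differentiableAt (by simp)).hasFDerivAt
  have h1 := (hd.clm_apply (hasFDerivAt_const a y)).clm_apply (hasFDerivAt_const b y)
  refine h1.congr_fderiv ?_
  ext z; simp

end IsMetricOn

end CoordMetric

/-! ### Connection of the warped metric. -/

namespace CoordMetric

variable {E : Type*} [NormedAddCommGroup E] [NormedSpace ℝ E]
  {E' : Type*} [NormedAddCommGroup E'] [NormedSpace ℝ E']

/-- The metric `e^{2 μ u} G_B ⊕ e^{2 u} G_F` on a product of vector spaces. -/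
def bcwp (μ : ℝ) (u : E → ℝ) (GB : E → (E →L[ℝ] E →L[ℝ] ℝ)) (GF : E' → (E' →L[ℝ] E' →L[ℝ] ℝ))
    (p : E × E') : E × E' →L[ℝ] E × E' →L[ℝ] ℝ :=
  Real.exp (2 * μ * u p.1) • (GB p.1).bilinearComp
      (ContinuousLinearMap.fst ℝ E E') (ContinuousLinearMap.fst ℝ E E')
    + Real.exp (2 * u p.1) • (GF p.2).bilinearComp
      (ContinuousLinearMap.snd ℝ E E') (ContinuousLinearMap.snd ℝ E E')

/-- The gradient of a function with respect to a coordinate metric. -/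
def gradient (G : E → (E →L[ℝ] E →L[ℝ] ℝ)) (u : E → ℝ) (y : E) : E :=
  ContinuousLinearMap.inverse (G y) (fderiv ℝ u y)

variable {GB : E → (E →L[ℝ] E →L[ℝ] ℝ)} {GF : E' → (E' →L[ℝ] E' →L[ℝ] ℝ)} {s : Set E} {s' : Set E'}
  {u : E → ℝ} {μ : ℝ}

lemma bcwp_apply (p v w : E × E') :
    bcwp μ u GB GF p v w = Real.exp (2 * μ * u p.1) * GB p.1 v.1 w.1
      + Real.exp (2 * u p.1) * GF p.2 v.2 w.2 := rfl

lemma contDiffOn_bcwp (hB : IsMetricOn GB s) (hF : IsMetricOn GF s') (hu : ContDiffOn ℝ ∞ u s) :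
    ContDiffOn ℝ ∞ (bcwp μ u GB GF) (s ×ˢ s') := by
  have hu' : ContDiffOn ℝ ∞ (fun p : E × E' => u p.1) (s ×ˢ s') :=
    hu.comp contDiff_fst.contDiffOn fun y hy => hy.1
  have h1 := (contDiffOn_bilinearComp (ContinuousLinearMap.fst ℝ E E') hB.contDiffOn).mono
    (t := s ×ˢ s') fun y hy => hy.1
  have h2 := (contDiffOn_bilinearComp (ContinuousLinearMap.snd ℝ E E') hF.contDiffOn).mono
    (t := s ×ˢ s') fun y hy => hy.2
  exact (((contDiffOn_const.mul hu').exp).smul h1).add (((contDiffOn_const.mul hu').exp).smul h2)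

lemma isMetricOn_bcwp (hB : IsMetricOn GB s) (hF : IsMetricOn GF s') (hu : ContDiffOn ℝ ∞ u s) :
    IsMetricOn (bcwp μ u GB GF) (s ×ˢ s') where
  isOpen := hB.isOpen.prod hF.isOpen
  contDiffOn := contDiffOn_bcwp hB hF hu
  symm y hy v w := by
    rw [bcwp_apply, bcwp_apply, hB.symm _ hy.1, hF.symm _ hy.2]
  nondegenerate y hy v hv := by
    refine Prod.ext (hB.nondegenerate _ hy.1 _ fun w => ?_)
      (hF.nondegenerate _ hy.2 _ fun w => ?_)
    · simpa [bcwp_apply] using hv (w, 0)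
    · simpa [bcwp_apply] using hv (0, w)

lemma fderiv_bcwp_apply (hB : IsMetricOn GB s) (hF : IsMetricOn GF s') (hu : ContDiffOn ℝ ∞ u s)
    {p : E × E'} (hp : p ∈ s ×ˢ s') (x v w : E × E') :
    fderiv ℝ (bcwp μ u GB GF) p x v w =
      Real.exp (2 * μ * u p.1) *
        (2 * μ * fderiv ℝ u p.1 x.1 * GB p.1 v.1 w.1 + fderiv ℝ GB p.1 x.1 v.1 w.1)
      + Real.exp (2 * u p.1) *
        (2 * fderiv ℝ u p.1 x.1 * GF p.2 v.2 w.2 + fderiv ℝ GF p.2 x.2 v.2 w.2) := by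
  have hd : HasFDerivAt (bcwp μ u GB GF) (fderiv ℝ (bcwp μ u GB GF) p) p :=
    (((isMetricOn_bcwp hB hF hu).contDiffAt hp).differentiableAt (by simp)).hasFDerivAt
  have h1 := (hd.clm_apply (hasFDerivAt_const v p)).clm_apply (hasFDerivAt_const w p)
  have hu1 : HasFDerivAt (fun p : E × E' => u p.1)
      ((fderiv ℝ u p.1).comp (ContinuousLinearMap.fst ℝ E E')) p :=
    HasFDerivAt.comp p (((hu.contDiffAt (hB.isOpen.mem_nhds hp.1)).differentiableAt
      (by simp)).hasFDerivAt) hasFDerivAt_fst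
  have hB1 : HasFDerivAt (fun p : E × E' => GB p.1)
      ((fderiv ℝ GB p.1).comp (ContinuousLinearMap.fst ℝ E E')) p :=
    HasFDerivAt.comp p (((hB.contDiffAt hp.1).differentiableAt (by simp)).hasFDerivAt)
      hasFDerivAt_fst
  have hF1 : HasFDerivAt (fun p : E × E' => GF p.2)
      ((fderiv ℝ GF p.2).comp (ContinuousLinearMap.snd ℝ E E')) p :=
    HasFDerivAt.comp p (((hF.contDiffAt hp.2).differentiableAt (by simp)).hasFDerivAt)
      hasFDerivAt_snd
  have h2 := (((hu1.const_mul (2 * μ)).exp.mul ((hB1.clm_apply (hasFDerivAt_const v.1 p)).clm_apply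
    (hasFDerivAt_const w.1 p))).add ((hu1.const_mul 2).exp.mul
      ((hF1.clm_apply (hasFDerivAt_const v.2 p)).clm_apply (hasFDerivAt_const w.2 p))))
  have h3 := DFunLike.congr_fun (h1.unique h2) x
  simp at h3
  rw [h3]
  ring

variable [FiniteDimensional ℝ E] [FiniteDimensional ℝ E']

lemma apply_gradient (hB : IsMetricOn GB s) {y : E} (hy : y ∈ s) (u : E → ℝ) (v : E) :
    GB y (gradient GB u y) v = fderiv ℝ u y v := by
  rw [gradient, hB.apply_inverse hy]

lemma contDiffAt_gradient (hB : IsMetricOn GB s) {y : E} (hy : y ∈ s) (hu : ContDiffOn ℝ ∞ u s) :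
    ContDiffAt ℝ ∞ (gradient GB u) y :=
  (hB.contDiffAt_inverse hy).clm_apply
    ((hu.contDiffAt (hB.isOpen.mem_nhds hy)).fderiv_right (by simp))

/-- Checked against the Koszul identity. The μ-terms are the conformal change on the base. The
factor e^{2(1-μ)u} is the fibre factor divided by the base factor: it arises when the derivative of
e^{2u} g_F along the base is raised by e^{2μu} g_B. -/
lemma christoffel_bcwp (hB : IsMetricOn GB s) (hF : IsMetricOn GF s') (hu : ContDiffOn ℝ ∞ u s)
    {p : E × E'} (hp : p ∈ s ×ˢ s') (v w : E × E') :
    christoffel (bcwp μ u GB GF) p v w =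
      (christoffel GB p.1 v.1 w.1 + μ • (fderiv ℝ u p.1 v.1 • w.1 + fderiv ℝ u p.1 w.1 • v.1
          - GB p.1 v.1 w.1 • gradient GB u p.1)
          - (Real.exp (2 * (1 - μ) * u p.1) * GF p.2 v.2 w.2) • gradient GB u p.1,
        christoffel GF p.2 v.2 w.2 + fderiv ℝ u p.1 v.1 • w.2 + fderiv ℝ u p.1 w.1 • v.2) := by
  refine (isMetricOn_bcwp hB hF hu).christoffel_eq_of hp fun z => ?_
  simp only [fderiv_bcwp_apply hB hF hu hp, bcwp_apply, map_add, map_sub, map_smul,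
    FunLike.coe_add, FunLike.coe_sub, FunLike.coe_smul, Pi.add_apply,
    Pi.sub_apply, Pi.smul_apply, smul_eq_mul, apply_gradient hB hp.1, hB.apply_christoffel hp.1,
    hF.apply_christoffel hp.2]
  have he : Real.exp (2 * μ * u p.1) * Real.exp (2 * (1 - μ) * u p.1) = Real.exp (2 * u p.1) := by
    rw [← Real.exp_add]; ring_nf
  linear_combination (-fderiv ℝ u p.1 z.1 * GF p.2 v.2 w.2) * he

end CoordMetric

/-! ### Differentiated connection and block traces. -/

namespace CoordMetric

variable {E : Type*} [NormedAddCommGroup E] [NormedSpace ℝ E]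
  {E' : Type*} [NormedAddCommGroup E'] [NormedSpace ℝ E']
  {GB : E → (E →L[ℝ] E →L[ℝ] ℝ)} {GF : E' → (E' →L[ℝ] E' →L[ℝ] ℝ)} {s : Set E} {s' : Set E'}
  {u : E → ℝ} {μ : ℝ} [FiniteDimensional ℝ E] [FiniteDimensional ℝ E']

lemma fderiv_christoffel_bcwp (hB : IsMetricOn GB s) (hF : IsMetricOn GF s')
    (hu : ContDiffOn ℝ ∞ u s) {p : E × E'} (hp : p ∈ s ×ˢ s') (x v w : E × E') :
    fderiv ℝ (christoffel (bcwp μ u GB GF)) p x v w =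
      (fderiv ℝ (christoffel GB) p.1 x.1 v.1 w.1
        + μ • (fderiv ℝ (fderiv ℝ u) p.1 x.1 v.1 • w.1 + fderiv ℝ (fderiv ℝ u) p.1 x.1 w.1 • v.1
          - (fderiv ℝ GB p.1 x.1 v.1 w.1 • gradient GB u p.1
            + GB p.1 v.1 w.1 • fderiv ℝ (gradient GB u) p.1 x.1))
        - ((Real.exp (2 * (1 - μ) * u p.1) * (2 * (1 - μ) * fderiv ℝ u p.1 x.1 * GF p.2 v.2 w.2
              + fderiv ℝ GF p.2 x.2 v.2 w.2)) • gradient GB u p.1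
          + (Real.exp (2 * (1 - μ) * u p.1) * GF p.2 v.2 w.2)
            • fderiv ℝ (gradient GB u) p.1 x.1),
       fderiv ℝ (christoffel GF) p.2 x.2 v.2 w.2 + fderiv ℝ (fderiv ℝ u) p.1 x.1 v.1 • w.2
        + fderiv ℝ (fderiv ℝ u) p.1 x.1 w.1 • v.2) := by
  have hG := isMetricOn_bcwp (μ := μ) hB hF hu
  have hfst : HasFDerivAt (fun p : E × E' => p.1) (ContinuousLinearMap.fst ℝ E E') p :=
    hasFDerivAt_fst
  have hsnd : HasFDerivAt (fun p : E × E' => p.2) (ContinuousLinearMap.snd ℝ E E') p :=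
    hasFDerivAt_snd
  have hua := hu.contDiffAt (hB.isOpen.mem_nhds hp.1)
  have hu1 := (hua.differentiableAt (by simp)).hasFDerivAt.comp p hfst
  have hdu : ∀ a : E, HasFDerivAt (fun p : E × E' => fderiv ℝ u p.1 a)
      (((fderiv ℝ (fderiv ℝ u) p.1).flip a).comp (ContinuousLinearMap.fst ℝ E E')) p := by
    intro a
    have h1 : HasFDerivAt (fderiv ℝ u) (fderiv ℝ (fderiv ℝ u) p.1) p.1 :=
      ((hua.fderiv_right (m := ∞) (by simp)).differentiableAt (by simp)).hasFDerivAt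
    have h2 := (h1.clm_apply (hasFDerivAt_const a p.1)).comp p hfst
    refine h2.congr_fderiv ?_
    ext z <;> simp
  have hU := ((contDiffAt_gradient hB hp.1 hu).differentiableAt (by simp)).hasFDerivAt.comp p hfst
  have hGB := (hB.hasFDerivAt_apply hp.1 v.1 w.1).comp p hfst
  have hGF := (hF.hasFDerivAt_apply hp.2 v.2 w.2).comp p hsnd
  have hCB := (hB.hasFDerivAt_christoffel_apply hp.1 v.1 w.1).comp p hfst
  have hCF := (hF.hasFDerivAt_christoffel_apply hp.2 v.2 w.2).comp p hsnd
  have hbase := (hCB.add (((((hdu v.1).smul_const w.1).add ((hdu w.1).smul_const v.1)).sub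
    (hGB.smul hU)).const_smul μ)).sub
      ((((hu1.const_mul (2 * (1 - μ))).exp.mul hGF).smul hU))
  have hfib := (hCF.add ((hdu v.1).smul_const w.2)).add ((hdu w.1).smul_const v.2)
  have h2 := (hbase.prodMk hfib).congr_of_eventuallyEq
    ((hG.eventually_mem hp).mono fun z hz => christoffel_bcwp (μ := μ) hB hF hu hz v w)
  have h3 := DFunLike.congr_fun ((hG.hasFDerivAt_christoffel_apply hp v w).unique h2) x
  simp only [ContinuousLinearMap.flip_apply] at h3
  rw [h3]
  refine Prod.ext ?_ ?_
  · simp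
    module
  · simp

/-- Split the identity of the product into its two projections and use cyclicity of the trace.
Thanks to this, only the diagonal blocks of the curvature endomorphism are ever computed. -/
lemma trace_prod_eq (T : E × E' →ₗ[ℝ] E × E') :
    LinearMap.trace ℝ (E × E') T
      = LinearMap.trace ℝ E (LinearMap.fst ℝ E E' ∘ₗ T ∘ₗ LinearMap.inl ℝ E E')
        + LinearMap.trace ℝ E' (LinearMap.snd ℝ E E' ∘ₗ T ∘ₗ LinearMap.inr ℝ E E') := by
  rw [LinearMap.trace_comp_comm' (T ∘ₗ LinearMap.inl ℝ E E') (LinearMap.fst ℝ E E'),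
    LinearMap.trace_comp_comm' (T ∘ₗ LinearMap.inr ℝ E E') (LinearMap.snd ℝ E E'), ← map_add]
  congr 1
  refine LinearMap.ext fun z => ?_
  simp [← map_add]

end CoordMetric

/-! ### Hessian, Laplacian and Ricci tensor of the warped metric. -/

namespace CoordMetric

variable {E : Type*} [NormedAddCommGroup E] [NormedSpace ℝ E]
  {E' : Type*} [NormedAddCommGroup E'] [NormedSpace ℝ E']

/-- The trace of a bilinear form `S` with respect to the metric `g`. -/
def metricTrace (g S : E →L[ℝ] E →L[ℝ] ℝ) : ℝ :=
  LinearMap.trace ℝ E ((ContinuousLinearMap.inverse g).comp S : E →L[ℝ] E)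

/-- The Hessian `∇²u` of a function with respect to a coordinate metric. -/
def hessian (G : E → (E →L[ℝ] E →L[ℝ] ℝ)) (u : E → ℝ) (y : E) : E →L[ℝ] E →L[ℝ] ℝ :=
  fderiv ℝ (fderiv ℝ u) y
    - (ContinuousLinearMap.compL ℝ E E ℝ (fderiv ℝ u y)).comp (christoffel G y)

/-- The Laplacian of a function with respect to a coordinate metric. -/
def laplacian (G : E → (E →L[ℝ] E →L[ℝ] ℝ)) (u : E → ℝ) (y : E) : ℝ :=
  metricTrace (G y) (hessian G u y)

lemma hessian_apply (G : E → (E →L[ℝ] E →L[ℝ] ℝ)) (u : E → ℝ) (y v w : E) :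
    hessian G u y v w = fderiv ℝ (fderiv ℝ u) y v w - fderiv ℝ u y (christoffel G y v w) := rfl

variable {GB : E → (E →L[ℝ] E →L[ℝ] ℝ)} {GF : E' → (E' →L[ℝ] E' →L[ℝ] ℝ)} {s : Set E} {s' : Set E'}
  {u : E → ℝ} {μ : ℝ}

lemma hessian_of_fderiv_eq_zero (G : E → (E →L[ℝ] E →L[ℝ] ℝ)) {y : E} (h : fderiv ℝ u y = 0) :
    hessian G u y = fderiv ℝ (fderiv ℝ u) y := by
  ext v w
  simp [hessian_apply, h]

lemma gradient_of_fderiv_eq_zero (G : E → (E →L[ℝ] E →L[ℝ] ℝ)) {y : E} (h : fderiv ℝ u y = 0) :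
    gradient G u y = 0 := by
  simp [gradient, h]

lemma laplacian_neg (G : E → (E →L[ℝ] E →L[ℝ] ℝ)) (u : E → ℝ) (y : E) :
    laplacian G (fun z => -u z) y = -laplacian G u y := by
  have h1 : fderiv ℝ (fun z => -u z) = fun z => -fderiv ℝ u z := funext fun z => fderiv_fun_neg
  have h2 : hessian G (fun z => -u z) y = -hessian G u y := by
    ext v w
    rw [hessian_apply, h1, fderiv_fun_neg]
    simp [hessian_apply]
    ring
  rw [laplacian, h2, laplacian, metricTrace, metricTrace, ContinuousLinearMap.comp_neg,
    ContinuousLinearMap.toLinearMap_neg, map_neg]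

lemma fderiv_fderiv_comm (hs : IsOpen s) {y : E} (hy : y ∈ s)
    (hu : ContDiffOn ℝ ∞ u s) (v w : E) :
    fderiv ℝ (fderiv ℝ u) y v w = fderiv ℝ (fderiv ℝ u) y w v :=
  ((hu.contDiffAt (hs.mem_nhds hy)).isSymmSndFDerivAt (by
    rw [minSmoothness_of_isRCLikeNormedField]; exact WithTop.coe_le_coe.2 (le_top : (2 : ℕ∞) ≤ ⊤))) v w

variable [FiniteDimensional ℝ E] [FiniteDimensional ℝ E']

/-- Differentiate g(∇u, w) = du(w) in the direction `x` and remove the derivative of g by metric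
compatibility. It is how derivatives of the gradient in the curvature become the Hessian, whose
trace is the Laplacian. -/
lemma fderiv_gradient_add_christoffel (hB : IsMetricOn GB s) {y : E} (hy : y ∈ s)
    (hu : ContDiffOn ℝ ∞ u s) (x : E) :
    fderiv ℝ (gradient GB u) y x + christoffel GB y x (gradient GB u y)
      = ContinuousLinearMap.inverse (GB y) (hessian GB u y x) := by
  rw [← hB.inverse_apply hy (fderiv ℝ (gradient GB u) y x + _)]
  congr 1
  ext w
  have hU := ((contDiffAt_gradient hB hy hu).differentiableAt (by simp)).hasFDerivAt
  have hG := ((hB.contDiffAt hy).differentiableAt (by simp)).hasFDerivAt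
  have hdu : HasFDerivAt (fderiv ℝ u) (fderiv ℝ (fderiv ℝ u) y) y :=
    (((hu.contDiffAt (hB.isOpen.mem_nhds hy)).fderiv_right (m := ∞)
      (by simp)).differentiableAt (by simp)).hasFDerivAt
  have h1 := (hG.clm_apply hU).clm_apply (hasFDerivAt_const w y)
  have h2 := (hdu.clm_apply (hasFDerivAt_const w y)).congr_of_eventuallyEq
    ((hB.eventually_mem hy).mono fun z hz => apply_gradient hB hz u w)
  have h3 := DFunLike.congr_fun (h1.unique h2) x
  have h4 := hB.fderiv_eq_christoffel hy x (gradient GB u y) w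
  have h5 := apply_gradient hB hy u (christoffel GB y x w)
  simp at h3
  rw [hessian_apply, map_add, FunLike.coe_add, Pi.add_apply]
  linarith

lemma fderiv_gradient_of_fderiv_eq_zero (hB : IsMetricOn GB s) {y : E} (hy : y ∈ s)
    (hu : ContDiffOn ℝ ∞ u s) (h : fderiv ℝ u y = 0) (x : E) :
    fderiv ℝ (gradient GB u) y x
      = ContinuousLinearMap.inverse (GB y) (fderiv ℝ (fderiv ℝ u) y x) := by
  have := fderiv_gradient_add_christoffel hB hy hu x
  rwa [gradient_of_fderiv_eq_zero GB h, map_zero, add_zero, hessian_of_fderiv_eq_zero GB h] at this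

/-- The Ricci tensor of a base conformal warped product in directions tangent to the fibre. -/
lemma ricci_bcwp_fiber (hB : IsMetricOn GB s) (hF : IsMetricOn GF s')
    (hu : ContDiffOn ℝ ∞ u s) {p : E × E'} (hp : p ∈ s ×ˢ s') (v w : E') :
    ricci (bcwp μ u GB GF) p (0, v) (0, w) = ricci GF p.2 v w
      - Real.exp (2 * (1 - μ) * u p.1) * GF p.2 v w * (laplacian GB u p.1
        + (Module.finrank ℝ E' + (Module.finrank ℝ E - 2) * μ)
          * fderiv ℝ u p.1 (gradient GB u p.1)) := by
  set U := gradient GB u p.1 with hUdef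
  set φ := Real.exp (2 * (1 - μ) * u p.1) with hφ
  rw [ricci_apply, trace_prod_eq]
  have h1 : LinearMap.fst ℝ E E' ∘ₗ (curvature (bcwp μ u GB GF) p (0, v) (0, w) :
      E × E' →ₗ[ℝ] E × E') ∘ₗ LinearMap.inl ℝ E E' =
      (-(φ * GF p.2 v w)) • ((((ContinuousLinearMap.inverse (GB p.1)).comp (hessian GB u p.1) :
        E →L[ℝ] E) : E →ₗ[ℝ] E) + (1 - 2 * μ) • (fderiv ℝ u p.1 : E →ₗ[ℝ] ℝ).smulRight U
        + (μ * fderiv ℝ u p.1 U) • LinearMap.id) := by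
    refine LinearMap.ext fun x => ?_
    simp [curvature_apply, fderiv_christoffel_bcwp hB hF hu hp, christoffel_bcwp hB hF hu hp,
      ← fderiv_gradient_add_christoffel hB hp.1 hu]
    rw [hB.symm _ hp.1 x, apply_gradient hB hp.1]
    module
  have h2 : LinearMap.snd ℝ E E' ∘ₗ (curvature (bcwp μ u GB GF) p (0, v) (0, w) :
      E × E' →ₗ[ℝ] E × E') ∘ₗ LinearMap.inr ℝ E E' =
      (curvature GF p.2 v w : E' →ₗ[ℝ] E')
        - (φ * GF p.2 v w * fderiv ℝ u p.1 U) • LinearMap.id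
        + (φ * fderiv ℝ u p.1 U) • (GF p.2 w : E' →ₗ[ℝ] ℝ).smulRight v := by
    refine LinearMap.ext fun x => ?_
    simp [curvature_apply, fderiv_christoffel_bcwp hB hF hu hp, christoffel_bcwp hB hF hu hp]
    rw [hF.symm _ hp.2 x w]
    module
  -- Up to the factor φ g_F(v, w), the terms in |∇u|² contribute -(1 - 2μ) - mμ from the base block
  -- and -k + 1 from the fibre block, in total -(k + (m - 2)μ).
  rw [h1, h2]
  simp only [map_add, map_sub, map_smul, LinearMap.trace_smulRight, LinearMap.trace_id,
    smul_eq_mul, ricci_apply, laplacian, metricTrace, ContinuousLinearMap.coe_coe]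
  rw [hF.symm _ hp.2 w v]
  ring

/-- The Ricci tensor of a base conformal warped product in directions tangent to the base, at a
critical point of the warping function. -/
lemma ricci_bcwp_base (hB : IsMetricOn GB s) (hF : IsMetricOn GF s')
    (hu : ContDiffOn ℝ ∞ u s) {p : E × E'} (hp : p ∈ s ×ˢ s') (h0 : fderiv ℝ u p.1 = 0) (v w : E) :
    ricci (bcwp μ u GB GF) p (v, 0) (w, 0) = ricci GB p.1 v w
      - μ * GB p.1 v w * laplacian GB u p.1
      - (Module.finrank ℝ E' + (Module.finrank ℝ E - 2) * μ) * hessian GB u p.1 v w := by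
  rw [ricci_apply, trace_prod_eq, laplacian, hessian_of_fderiv_eq_zero GB h0]
  have hD := fderiv_fderiv_comm hB.isOpen hp.1 hu
  have h1 : LinearMap.fst ℝ E E' ∘ₗ (curvature (bcwp μ u GB GF) p (v, 0) (w, 0) :
      E × E' →ₗ[ℝ] E × E') ∘ₗ LinearMap.inl ℝ E E' =
      (curvature GB p.1 v w : E →ₗ[ℝ] E)
        + μ • ((fderiv ℝ (fderiv ℝ u) p.1 w : E →ₗ[ℝ] ℝ).smulRight v
          - GB p.1 v w • (((ContinuousLinearMap.inverse (GB p.1)).comp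
              (fderiv ℝ (fderiv ℝ u) p.1) : E →L[ℝ] E) : E →ₗ[ℝ] E)
          - fderiv ℝ (fderiv ℝ u) p.1 v w • LinearMap.id
          + (GB p.1 w : E →ₗ[ℝ] ℝ).smulRight
              (ContinuousLinearMap.inverse (GB p.1) (fderiv ℝ (fderiv ℝ u) p.1 v))) := by
    refine LinearMap.ext fun x => ?_
    simp [curvature_apply, fderiv_christoffel_bcwp hB hF hu hp, christoffel_bcwp hB hF hu hp, h0,
      gradient_of_fderiv_eq_zero GB h0, fderiv_gradient_of_fderiv_eq_zero hB hp.1 hu h0]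
    rw [hB.symm _ hp.1 x, hD v x, hD w x]
    module
  have h2 : LinearMap.snd ℝ E E' ∘ₗ (curvature (bcwp μ u GB GF) p (v, 0) (w, 0) :
      E × E' →ₗ[ℝ] E × E') ∘ₗ LinearMap.inr ℝ E E' =
      (-fderiv ℝ (fderiv ℝ u) p.1 v w) • LinearMap.id := by
    refine LinearMap.ext fun x => ?_
    simp [curvature_apply, fderiv_christoffel_bcwp hB hF hu hp, christoffel_bcwp hB hF hu hp, h0,
      gradient_of_fderiv_eq_zero GB h0]
  -- In the base block the two rank-one maps each trace to the Hessian and the identity gives -m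
  -- times it, hence μ(2 - m); the fibre block adds -k.
  rw [h1, h2]
  simp only [map_add, map_sub, map_smul, LinearMap.trace_smulRight, LinearMap.trace_id,
    smul_eq_mul, ricci_apply, metricTrace, ContinuousLinearMap.coe_coe]
  rw [hB.symm _ hp.1 w, hB.apply_inverse hp.1, hD w v]
  ring

/-- The Ricci tensor of a product metric. -/
lemma ricci_bcwp_of_fderiv_eq_zero (hB : IsMetricOn GB s) (hF : IsMetricOn GF s')
    (hu : ContDiffOn ℝ ∞ u s) {p : E × E'} (hp : p ∈ s ×ˢ s') (h0 : fderiv ℝ u p.1 = 0)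
    (h1 : fderiv ℝ (fderiv ℝ u) p.1 = 0) (v w : E × E') :
    ricci (bcwp μ u GB GF) p v w = ricci GB p.1 v.1 w.1 + ricci GF p.2 v.2 w.2 := by
  rw [ricci_apply, ricci_apply, ricci_apply, trace_prod_eq]
  congr 2 <;>
  · refine LinearMap.ext fun x => ?_
    simp [curvature_apply, fderiv_christoffel_bcwp hB hF hu hp, christoffel_bcwp hB hF hu hp, h0,
      h1, gradient_of_fderiv_eq_zero GB h0, fderiv_gradient_of_fderiv_eq_zero hB hp.1 hu h0]

end CoordMetric

/-! ### Maximum principles -/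

section MaximumPrinciple

/-- Restrict to the line through `x` in the direction `z`. A positive second derivative would make
the point a local minimum as well, hence the restriction locally constant with second derivative 0.
-/
lemma IsLocalMax.fderiv_fderiv_nonpos {E : Type*} [NormedAddCommGroup E] [NormedSpace ℝ E]
    {f : E → ℝ} {x : E} (h : IsLocalMax f x) (hf : ContDiffAt ℝ 2 f x) (z : E) :
    fderiv ℝ (fderiv ℝ f) x z z ≤ 0 := by
  by_contra! hpos
  set φ : ℝ → ℝ := fun t => f (x + t • z) with hφ
  have hline : ∀ t : ℝ, HasDerivAt (fun t : ℝ => x + t • z) z t := fun t => by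
    simpa using ((hasDerivAt_id t).smul_const z).const_add x
  have hcont : Filter.Tendsto (fun t : ℝ => x + t • z) (𝓝 0) (𝓝 x) := by
    simpa using (hline 0).continuousAt.tendsto
  have hd : deriv φ =ᶠ[𝓝 0] fun t => fderiv ℝ f (x + t • z) z := by
    have h1 : ∀ᶠ y in 𝓝 x, DifferentiableAt ℝ f y :=
      (hf.eventually (by simp)).mono fun y hy => hy.differentiableAt (by simp)
    filter_upwards [hcont.eventually h1] with t ht
    exact (ht.hasFDerivAt.comp_hasDerivAt t (hline t)).deriv
  have hdd : deriv (deriv φ) 0 = fderiv ℝ (fderiv ℝ f) x z z := by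
    rw [hd.deriv_eq]
    have h2 : HasFDerivAt (fderiv ℝ f) (fderiv ℝ (fderiv ℝ f) x) x :=
      ((hf.fderiv_right (m := 1) (by norm_num)).differentiableAt (by simp)).hasFDerivAt
    have h3 : HasDerivAt (fun t : ℝ => fderiv ℝ f (x + t • z)) (fderiv ℝ (fderiv ℝ f) x z) 0 :=
      h2.comp_hasDerivAt_of_eq (0 : ℝ) (hline 0) (by simp)
    have h4 := (((ContinuousLinearMap.apply ℝ ℝ) z).hasFDerivAt (x := fderiv ℝ f
      (x + (0 : ℝ) • z))).comp_hasDerivAt (0 : ℝ) h3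
    exact h4.deriv
  have hmax : IsLocalMax φ 0 := by
    have := hcont.eventually h
    simpa [IsLocalMax, IsMaxFilter, hφ] using this
  have hc : ContinuousAt φ 0 := by
    have : ContinuousAt f (x + (0 : ℝ) • z) := by simpa using hf.continuousAt
    exact ContinuousAt.comp (f := fun t : ℝ => x + t • z) this (hline 0).continuousAt
  have hmin : IsLocalMin φ 0 :=
    isLocalMin_of_deriv_deriv_pos (by rw [hdd]; exact hpos) hmax.deriv_eq_zero hc
  have hconst : φ =ᶠ[𝓝 0] fun _ => φ 0 := by
    filter_upwards [hmax, hmin] with t h1 h2 using le_antisymm h1 h2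
  have h4 := hconst.deriv.deriv_eq
  rw [hdd] at h4
  simp at h4
  exact hpos.ne' h4

variable {E : Type*} [NormedAddCommGroup E] [InnerProductSpace ℝ E]

variable (E) in
/-- The inner product of a real inner product space as a continuous bilinear form. -/
def innerForm : E →L[ℝ] E →L[ℝ] ℝ := innerSL ℝ

@[simp] lemma innerForm_apply (v w : E) : innerForm E v w = inner ℝ v w := rfl

lemma hasFDerivAt_exp_neg_mul_norm_sq (α : ℝ) (c x : E) :
    HasFDerivAt (fun x => Real.exp (-α * ‖x - c‖ ^ 2))
      ((-2 * α * Real.exp (-α * ‖x - c‖ ^ 2)) • innerForm E (x - c)) x := by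
  have h := ((((hasFDerivAt_id x).sub_const c).norm_sq).const_mul (-α)).exp
  refine h.congr_fderiv ?_
  ext z
  simp
  ring

lemma hasFDerivAt_fderiv_exp_neg_mul_norm_sq (α : ℝ) (c x : E) :
    HasFDerivAt (fderiv ℝ fun x => Real.exp (-α * ‖x - c‖ ^ 2))
      (Real.exp (-α * ‖x - c‖ ^ 2) •
        ((4 * α ^ 2) • (innerForm E (x - c)).smulRight (innerForm E (x - c))
          - (2 * α) • innerForm E)) x := by
  have h0 : (fderiv ℝ fun x : E => Real.exp (-α * ‖x - c‖ ^ 2)) =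
      fun x => (-2 * α * Real.exp (-α * ‖x - c‖ ^ 2)) • innerForm E (x - c) :=
    funext fun x => (hasFDerivAt_exp_neg_mul_norm_sq α c x).fderiv
  rw [h0]
  have h1 : HasFDerivAt (fun x : E => innerForm E (x - c))
      (innerForm E) x := by
    have := (innerForm E).hasFDerivAt.comp x ((hasFDerivAt_id x).sub_const c)
    exact this.congr_fderiv (by ext; simp)
  have h2 := ((hasFDerivAt_exp_neg_mul_norm_sq α c x).const_mul (-2 * α)).smul h1
  refine h2.congr_fderiv ?_
  ext v w
  simp
  ring

/-- Parallelogram law about the midpoint c: |x - p|² + |x - q|² = 2|x - c|² + 2|c - p|² ≤ |q - p|².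
Passing to this smaller ball leaves `q` as the only point of contact in Hopf's argument. -/
lemma norm_sub_lt_of_midpoint {p q x : E} (hx : ‖x - midpoint ℝ p q‖ ≤ ‖q - p‖ / 2) (hq : x ≠ q) :
    ‖x - p‖ < ‖q - p‖ := by
  by_contra! h
  apply hq
  set c := midpoint ℝ p q with hc
  have e1 : q - p = (2 : ℝ) • (c - p) := by
    rw [hc, midpoint_eq_smul_add]; simp only [invOf_eq_inv]; module
  have e2 : x - q = (x - c) - (c - p) := by
    rw [hc, midpoint_eq_smul_add]; simp only [invOf_eq_inv]; module
  have e3 : x - p = (x - c) + (c - p) := by abel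
  have n1 : ‖q - p‖ = 2 * ‖c - p‖ := by rw [e1, norm_smul]; norm_num
  have s1 := norm_add_sq_real (x - c) (c - p)
  have s2 := norm_sub_sq_real (x - c) (c - p)
  rw [← e3] at s1
  rw [← e2] at s2
  have : ‖x - q‖ ^ 2 ≤ 0 := by
    have h3 : ‖x - c‖ ^ 2 ≤ ‖c - p‖ ^ 2 := by gcongr; linarith
    have h4 : (2 * ‖c - p‖) ^ 2 ≤ ‖x - p‖ ^ 2 := by gcongr; linarith
    nlinarith
  have h5 : ‖x - q‖ = 0 := by nlinarith [norm_nonneg (x - q)]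
  exact sub_eq_zero.1 (norm_eq_zero.1 h5)

/-- Hopf's strong maximum principle, local form: near an interior maximum point, a subsolution of
an elliptic equation without term of order zero is constant. -/
theorem eventually_eq_of_subsolution [FiniteDimensional ℝ E] {s : Set E} (hs : IsOpen s)
    {f : E → ℝ} (hf : ContDiffOn ℝ 2 f s) {A : E → (E →L[ℝ] E →L[ℝ] ℝ) →L[ℝ] ℝ}
    {b : E → (E →L[ℝ] ℝ) →L[ℝ] ℝ} (hA : ContinuousOn A s) (hb : ContinuousOn b s)
    (hA_nonpos : ∀ x ∈ s, ∀ S : E →L[ℝ] E →L[ℝ] ℝ, (∀ z, S z z ≤ 0) → A x S ≤ 0)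
    (hA_pos : ∀ x ∈ s, ∀ ξ : E →L[ℝ] ℝ, ξ ≠ 0 → 0 < A x (ξ.smulRight ξ))
    (hL : ∀ x ∈ s, 0 ≤ A x (fderiv ℝ (fderiv ℝ f) x) + b x (fderiv ℝ f x))
    {M : ℝ} (hM : ∀ x ∈ s, f x ≤ M) {x₀ : E} (hx₀ : x₀ ∈ s) (hfx₀ : f x₀ = M) :
    ∀ᶠ x in 𝓝 x₀, f x = M := by
  by_contra hne
  have hfc : ContinuousOn f s := hf.continuousOn
  obtain ⟨r₀, hr₀, hball⟩ := Metric.isOpen_iff.1 hs x₀ hx₀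
  -- A point closer than r to `p`, itself within r of `x₀`, stays in the closed ball of radius 2r,
  -- which still lies in `s`.
  set r := r₀ / 4 with hr
  have hrpos : 0 < r := by positivity
  have hsub : Metric.closedBall x₀ (2 * r) ⊆ s :=
    (Metric.closedBall_subset_ball (by linarith)).trans hball
  obtain ⟨p, hp, hpM⟩ : ∃ p ∈ Metric.ball x₀ r, f p ≠ M := by
    by_contra! hcon
    exact hne (Filter.eventually_of_mem (Metric.ball_mem_nhds x₀ hrpos) hcon)
  rw [Metric.mem_ball] at hp
  set K : Set E := Metric.closedBall x₀ (2 * r) ∩ f ⁻¹' {M} with hK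
  have hKc : IsCompact K :=
    (isCompact_closedBall x₀ (2 * r)).of_isClosed_subset
      ((hfc.mono hsub).preimage_isClosed_of_isClosed Metric.isClosed_closedBall isClosed_singleton)
      Set.inter_subset_left
  have hx₀K : x₀ ∈ K := ⟨Metric.mem_closedBall_self (by positivity), hfx₀⟩
  -- A contact point nearest to `p`: the open ball about `p` through `q` contains no point where f =
  -- M.
  obtain ⟨q, hqK, hq⟩ := hKc.exists_infDist_eq_dist ⟨x₀, hx₀K⟩ p
  have hR : dist p q < r := by
    rw [← hq]
    exact (Metric.infDist_le_dist_of_mem hx₀K).trans_lt hp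
  have hqs : q ∈ s := hsub hqK.1
  have hfq : f q = M := hqK.2
  have hpq : q ≠ p := fun h => hpM (h ▸ hfq)
  have hlt : ∀ x, ‖x - p‖ < ‖q - p‖ → x ∈ s → f x < M := by
    intro x hx hxs
    refine lt_of_le_of_ne (hM x hxs) fun hxM => ?_
    rw [← dist_eq_norm, ← dist_eq_norm, dist_comm x, dist_comm q] at hx
    have hxK : x ∈ K := by
      refine ⟨?_, hxM⟩
      rw [Metric.mem_closedBall]
      have := dist_triangle x p x₀
      rw [dist_comm x p] at this
      linarith
    have := Metric.infDist_le_dist_of_mem (x := p) hxK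
    linarith
  set c := midpoint ℝ p q with hc
  have hqc : ‖q - c‖ = ‖q - p‖ / 2 := by
    have : q - c = (1 / 2 : ℝ) • (q - p) := by
      rw [hc, midpoint_eq_smul_add]; simp only [invOf_eq_inv]; module
    rw [this, norm_smul]
    norm_num
    ring
  have hξ : innerForm E (q - c) ≠ 0 := by
    intro h
    have h1 : inner ℝ (q - c) (q - c) = 0 := DFunLike.congr_fun h (q - c)
    have h2 : q - c = 0 := inner_self_eq_zero.1 h1
    rw [h2, norm_zero] at hqc
    exact hpq (sub_eq_zero.1 (norm_eq_zero.1 (by linarith)))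
  set a : ℝ := A q ((innerForm E (q - c)).smulRight (innerForm E (q - c))) with ha
  have hapos : 0 < a := hA_pos q hqs _ hξ
  set d : ℝ := A q (innerForm E) + b q (innerForm E (q - c)) with hd
  -- Ellipticity makes the term quadratic in α win; the witness is chosen so that 2αa = |d| + 1 > d.
  obtain ⟨α, hα, hαq⟩ : ∃ α : ℝ, 0 < α ∧ 0 < 4 * α ^ 2 * a - 2 * α * d := by
    refine ⟨(|d| + 1) / (2 * a), by positivity, ?_⟩
    have h1 : 2 * ((|d| + 1) / (2 * a)) * a = |d| + 1 := by field_simp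
    have h2 : 0 < (|d| + 1) / (2 * a) := by positivity
    have h3 := le_abs_self d
    have : 4 * ((|d| + 1) / (2 * a)) ^ 2 * a - 2 * ((|d| + 1) / (2 * a)) * d
        = 2 * ((|d| + 1) / (2 * a)) * (2 * ((|d| + 1) / (2 * a)) * a - d) := by ring
    rw [this, h1]
    apply mul_pos <;> linarith
  -- The operator sends the barrier h = exp(-α|x - c|²) to h Φ. Continuity of Φ spreads its
  -- positivity from `q` to a small closed ball.
  set Φ : E → ℝ := fun x => 4 * α ^ 2 * A x ((innerForm E (x - c)).smulRight (innerForm E (x - c)))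
    - 2 * α * (A x (innerForm E) + b x (innerForm E (x - c))) with hΦ
  have hΦc : ContinuousAt Φ q := by
    have hAc := hA.continuousAt (hs.mem_nhds hqs)
    have hbc := hb.continuousAt (hs.mem_nhds hqs)
    have hi : ContinuousAt (fun x : E => innerForm E (x - c)) q := by fun_prop
    have hi2 : ContinuousAt (fun x : E => (innerForm E (x - c)).smulRight (innerForm E (x - c))) q := by
      have := ((ContinuousLinearMap.smulRightL ℝ E (E →L[ℝ] ℝ)).continuous.continuousAt.comp
        hi).clm_apply hi
      exact this
    exact (continuousAt_const.mul (hAc.clm_apply hi2)).sub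
      (continuousAt_const.mul ((hAc.clm_apply continuousAt_const).add (hbc.clm_apply hi)))
  obtain ⟨r', hr', hr's⟩ : ∃ r' > 0, Metric.closedBall q r' ⊆ s ∩ {x | 0 < Φ x} :=
    Metric.nhds_basis_closedBall.mem_iff.1
      (Filter.inter_mem (hs.mem_nhds hqs) (hΦc.eventually_const_lt hαq))
  set h : E → ℝ := fun x => Real.exp (-α * ‖x - c‖ ^ 2) with hh
  set h₀ : ℝ := Real.exp (-α * ‖q - c‖ ^ 2) with hh₀
  have hcomp : IsCompact (Metric.sphere q r' ∩ Metric.closedBall c ‖q - c‖) :=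
    (isCompact_sphere q r').inter_right Metric.isClosed_closedBall
  have hlt' : ∀ x ∈ Metric.sphere q r' ∩ Metric.closedBall c ‖q - c‖, f x < M := by
    rintro x ⟨hx1, hx2⟩
    refine hlt x (norm_sub_lt_of_midpoint ?_ ?_) (hr's (Metric.sphere_subset_closedBall hx1)).1
    · rw [← hc, ← hqc, ← dist_eq_norm]; exact hx2
    · rintro rfl
      rw [Metric.mem_sphere, dist_self] at hx1
      exact hr'.ne hx1
  -- This compact piece of the sphere misses `q`, so f is bounded away from M on it. As h ≤ 1, the
  -- perturbation ε h stays below M there.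
  obtain ⟨ε, hε, hεlt⟩ : ∃ ε > 0, ∀ x ∈ Metric.sphere q r' ∩ Metric.closedBall c ‖q - c‖,
      f x + ε < M := by
    rcases (Metric.sphere q r' ∩ Metric.closedBall c ‖q - c‖).eq_empty_or_nonempty with he | hne
    · exact ⟨1, one_pos, by simp [he]⟩
    · obtain ⟨x₁, hx₁, hmax⟩ := hcomp.exists_isMaxOn hne
        (hfc.mono fun x hx => (hr's (Metric.sphere_subset_closedBall hx.1)).1)
      refine ⟨(M - f x₁) / 2, by linarith [hlt' x₁ hx₁], fun x hx => ?_⟩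
      have h1 : f x ≤ f x₁ := hmax hx
      linarith [hlt' x₁ hx₁]
  have hh1 : ∀ x, h x ≤ 1 := fun x => Real.exp_le_one_iff.2 (by nlinarith [sq_nonneg ‖x - c‖])
  have hhc : Continuous h := by fun_prop
  have hFc : ContinuousOn (fun x => f x + ε * h x) (Metric.closedBall q r') :=
    (hfc.mono fun x hx => (hr's hx).1).add (continuous_const.mul hhc).continuousOn
  obtain ⟨z, hz, hzmax⟩ := (isCompact_closedBall q r').exists_isMaxOn
    ⟨q, Metric.mem_closedBall_self hr'.le⟩ hFc
  have hzs : z ∈ s := (hr's hz).1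
  have hFz : M + ε * h₀ ≤ f z + ε * h z := by
    have : f q + ε * h q ≤ f z + ε * h z := hzmax (Metric.mem_closedBall_self hr'.le)
    rwa [hfq] at this
  -- On the sphere f + εh is smaller than its value M + ε h(q) at the centre: inside the ball about
  -- `c` by the choice of ε, outside it because h < h(q) and f ≤ M.
  have hzball : z ∈ Metric.ball q r' := by
    rw [Metric.mem_ball]
    refine lt_of_le_of_ne hz fun hzr => ?_
    by_cases hzc : z ∈ Metric.closedBall c ‖q - c‖
    · have h1 := hεlt z ⟨hzr, hzc⟩
      have h2 := hh1 z
      have h3 : 0 < h₀ := Real.exp_pos _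
      nlinarith
    · rw [Metric.mem_closedBall, not_le, dist_eq_norm] at hzc
      have h1 : h z < h₀ := by
        apply Real.exp_lt_exp.2
        have : ‖q - c‖ ^ 2 < ‖z - c‖ ^ 2 := by gcongr
        nlinarith
      have h2 := hM z hzs
      nlinarith
  have hloc : IsLocalMax (fun x => f x + ε * h x) z :=
    hzmax.isLocalMax (Filter.mem_of_superset (Metric.isOpen_ball.mem_nhds hzball)
      Metric.ball_subset_closedBall)
  have hh2 : ContDiff ℝ 2 h := by
    have : ContDiff ℝ 2 fun x : E => ‖x - c‖ ^ 2 := (contDiff_id.sub contDiff_const).norm_sq ℝ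
    exact (contDiff_const.mul this).exp
  have hfz := hf.contDiffAt (hs.mem_nhds hzs)
  have hF2 : ContDiffAt ℝ 2 (fun x => f x + ε * h x) z :=
    hfz.add (contDiffAt_const.mul hh2.contDiffAt)
  have hfd : ∀ x ∈ s, HasFDerivAt (fun x => f x + ε * h x) (fderiv ℝ f x + ε • fderiv ℝ h x) x :=
    fun x hx => (((hf.contDiffAt (hs.mem_nhds hx)).differentiableAt (by simp)).hasFDerivAt).add
      ((hh2.differentiable (by simp) x).hasFDerivAt.const_mul ε)
  have hD1 : fderiv ℝ f z + ε • fderiv ℝ h z = 0 := by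
    rw [← (hfd z hzs).fderiv]; exact hloc.fderiv_eq_zero
  have hD2 : fderiv ℝ (fderiv ℝ fun x => f x + ε * h x) z
      = fderiv ℝ (fderiv ℝ f) z + ε • fderiv ℝ (fderiv ℝ h) z := by
    have h1 : (fderiv ℝ fun x => f x + ε * h x) =ᶠ[𝓝 z]
        fun x => fderiv ℝ f x + ε • fderiv ℝ h x :=
      Filter.eventually_of_mem (hs.mem_nhds hzs) fun x hx => (hfd x hx).fderiv
    rw [h1.fderiv_eq]
    exact ((((hfz.fderiv_right (m := 1) (by norm_num)).differentiableAt
      (by simp)).hasFDerivAt).add (((hasFDerivAt_fderiv_exp_neg_mul_norm_sq α c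
        z).differentiableAt.hasFDerivAt).const_smul ε)).fderiv
  -- At the interior maximum `z` the operator applied to f + εh is nonpositive, whereas it is ≥ 0 on
  -- f and > 0 on h.
  have hneg := hA_nonpos z hzs _ (hloc.fderiv_fderiv_nonpos hF2)
  have hb0 := congrArg (b z) hD1
  have hLz := hL z hzs
  have hΦz : 0 < Φ z := (hr's hz).2
  have hLh : A z (fderiv ℝ (fderiv ℝ h) z) + b z (fderiv ℝ h z) = h z * Φ z := by
    rw [(hasFDerivAt_fderiv_exp_neg_mul_norm_sq α c z).fderiv,
      (hasFDerivAt_exp_neg_mul_norm_sq α c z).fderiv]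
    simp only [map_smul, map_sub, smul_eq_mul, hΦ, hh]
    ring
  rw [hD2, map_add, map_smul] at hneg
  rw [map_add, map_smul, map_zero] at hb0
  have : 0 < ε * (h z * Φ z) := mul_pos hε (mul_pos (Real.exp_pos _) hΦz)
  rw [← hLh] at this
  simp only [smul_eq_mul] at hneg hb0
  linarith

end MaximumPrinciple

/-! ### Ellipticity of the metric trace. -/

namespace CoordMetric

variable {E : Type*} [NormedAddCommGroup E] [NormedSpace ℝ E] [FiniteDimensional ℝ E]
  {g : E →L[ℝ] E →L[ℝ] ℝ}

lemma isInvertible_of_pos (hpos : ∀ v, v ≠ 0 → 0 < g v v) : g.IsInvertible :=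
  isInvertible_of_nondegenerate g fun v hv => by
    by_contra h
    exact (hpos v h).ne' (hv v)

/-- In a g-orthogonal basis the diagonal entries of g⁻¹S are S(vᵢ, vᵢ) / g(vᵢ, vᵢ). -/
lemma metricTrace_nonpos (hsymm : ∀ v w, g v w = g w v) (hpos : ∀ v, v ≠ 0 → 0 < g v v)
    {S : E →L[ℝ] E →L[ℝ] ℝ} (hS : ∀ z, S z z ≤ 0) : metricTrace g S ≤ 0 := by
  have hinv := isInvertible_of_pos hpos
  obtain ⟨v, hv⟩ := LinearMap.BilinForm.exists_orthogonal_basis (K := ℝ) (V := E)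
    (B := g.toLinearMap₁₂) ⟨fun x y => hsymm x y⟩
  rw [metricTrace, LinearMap.trace_eq_matrix_trace ℝ v]
  refine Finset.sum_nonpos fun i _ => ?_
  rw [Matrix.diag_apply, LinearMap.toMatrix_apply]
  set T : E := g.inverse (S (v i)) with hT
  change v.repr T i ≤ 0
  have h1 : g T (v i) = S (v i) (v i) := by rw [hT, hinv.self_apply_inverse]
  have h2 : g T (v i) = v.repr T i * g (v i) (v i) := by
    conv_lhs => rw [← v.sum_repr T]
    rw [map_sum, FunLike.coe_sum, Finset.sum_apply, Finset.sum_eq_single i]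
    · simp
    · intro j _ hj
      have : g (v j) (v i) = 0 := hv hj
      simp [this]
    · simp
  have h3 := hpos (v i) (v.ne_zero i)
  have h4 := hS (v i)
  rw [← h1, h2] at h4
  exact nonpos_of_mul_nonpos_left h4 h3

/-- The endomorphism has rank one, and its trace ξ(g⁻¹ξ) is the g-square of the vector g⁻¹ξ. -/
lemma metricTrace_smulRight_self_pos (hpos : ∀ v, v ≠ 0 → 0 < g v v) {ξ : E →L[ℝ] ℝ} (hξ : ξ ≠ 0) :
    0 < metricTrace g (ξ.smulRight ξ) := by
  have hinv := isInvertible_of_pos hpos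
  have h1 : (((g.inverse).comp (ξ.smulRight ξ) : E →L[ℝ] E) : E →ₗ[ℝ] E)
      = (ξ : E →ₗ[ℝ] ℝ).smulRight (g.inverse ξ) := by
    ext x; simp
  have h2 : g (g.inverse ξ) = ξ := hinv.self_apply_inverse ξ
  rw [metricTrace, h1, LinearMap.trace_smulRight]
  change 0 < ξ (g.inverse ξ)
  conv_rhs => rw [← h2]
  rw [h2]
  have h3 := hpos (g.inverse ξ) fun h0 => hξ (by rw [← h2, h0, map_zero])
  rwa [h2] at h3

end CoordMetric

/-! ### Maximum principle for the Laplacian and the traced base equation. -/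

namespace CoordMetric

variable {E : Type*} [NormedAddCommGroup E] [InnerProductSpace ℝ E] [FiniteDimensional ℝ E] in
/-- A function satisfying `Δu + γ |∇u|² = 0` is constant near an interior maximum point. -/
lemma eventually_eq_of_laplacian_add_eq_zero {G : E → (E →L[ℝ] E →L[ℝ] ℝ)} {s : Set E}
    (hG : IsMetricOn G s) (hpos : ∀ y ∈ s, ∀ v, v ≠ 0 → 0 < G y v v) {u : E → ℝ}
    (hu : ContDiffOn ℝ ∞ u s) {γ : ℝ}
    (hL : ∀ y ∈ s, laplacian G u y + γ * fderiv ℝ u y (gradient G u y) = 0) {M : ℝ}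
    (hM : ∀ y ∈ s, u y ≤ M) {x : E} (hx : x ∈ s) (hux : u x = M) : ∀ᶠ y in 𝓝 x, u y = M := by
  let tr : (E →L[ℝ] E) →L[ℝ] ℝ :=
    LinearMap.toContinuousLinearMap (LinearMap.trace ℝ E ∘ₗ ContinuousLinearMap.coeLM ℝ)
  let A : E → (E →L[ℝ] E →L[ℝ] ℝ) →L[ℝ] ℝ := fun y =>
    tr ∘L ContinuousLinearMap.compL ℝ E (E →L[ℝ] ℝ) E (ContinuousLinearMap.inverse (G y))
  -- The equation is read as linear: one factor of |∇u|² is frozen as a continuous coefficient, and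
  -- the Christoffel part of the Hessian joins the first-order term. The inner product on `E` serves
  -- only the barrier and is unrelated to `G`.
  let b : E → (E →L[ℝ] ℝ) →L[ℝ] ℝ := fun y =>
    γ • ContinuousLinearMap.apply ℝ ℝ (gradient G u y)
      - A y ∘L ((ContinuousLinearMap.compL ℝ E (E →L[ℝ] E) (E →L[ℝ] ℝ)).flip (christoffel G y) ∘L
        ContinuousLinearMap.compL ℝ E E ℝ)
  have hAapp : ∀ y S, A y S = metricTrace (G y) S := fun y S => rfl
  have hA : ContinuousOn A s := fun y hy =>
    (continuousAt_const.clm_comp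
      ((ContinuousLinearMap.compL ℝ E (E →L[ℝ] ℝ) E).continuous.continuousAt.comp
        (hG.contDiffAt_inverse hy).continuousAt)).continuousWithinAt
  have hb : ContinuousOn b s := fun y hy => by
    refine ContinuousWithinAt.sub ?_ ((hA y hy).clm_comp (ContinuousWithinAt.clm_comp ?_
      continuousWithinAt_const))
    · exact ((ContinuousLinearMap.apply ℝ ℝ).continuous.continuousAt.comp
        (contDiffAt_gradient hG hy hu).continuousAt).continuousWithinAt.const_smul γ
    · exact ((ContinuousLinearMap.compL ℝ E (E →L[ℝ] E)
        (E →L[ℝ] ℝ)).flip.continuous.continuousAt.comp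
          (hG.contDiffAt_christoffel hy).continuousAt).continuousWithinAt
  have hAb : ∀ y, A y (fderiv ℝ (fderiv ℝ u) y) + b y (fderiv ℝ u y)
      = laplacian G u y + γ * fderiv ℝ u y (gradient G u y) := by
    intro y
    have h1 : b y (fderiv ℝ u y) = γ * fderiv ℝ u y (gradient G u y)
      - A y ((ContinuousLinearMap.compL ℝ E E ℝ (fderiv ℝ u y)).comp (christoffel G y)) := rfl
    rw [h1, laplacian, ← hAapp, hessian, map_sub]
    ring
  exact eventually_eq_of_subsolution hG.isOpen (hu.of_le (WithTop.coe_le_coe.2 le_top)) hA hb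
    (fun y hy S hS => metricTrace_nonpos (hG.symm y hy) (hpos y hy) hS)
    (fun y hy ξ hξ => metricTrace_smulRight_self_pos (hpos y hy) hξ)
    (fun y hy => by rw [hAb, hL y hy]) hM hx hux

variable {E : Type*} [NormedAddCommGroup E] [NormedSpace ℝ E] [FiniteDimensional ℝ E]
  {E' : Type*} [NormedAddCommGroup E'] [NormedSpace ℝ E'] [FiniteDimensional ℝ E']
  {GB : E → (E →L[ℝ] E →L[ℝ] ℝ)} {GF : E' → (E' →L[ℝ] E' →L[ℝ] ℝ)} {s : Set E} {s' : Set E'}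
  {u : E → ℝ} {μ : ℝ}

lemma laplacian_nonpos_of_isLocalMax (hG : IsMetricOn GB s) {y : E} (hy : y ∈ s)
    (hpos : ∀ v, v ≠ 0 → 0 < GB y v v) (hu : ContDiffOn ℝ ∞ u s) (hmax : IsLocalMax u y) :
    laplacian GB u y ≤ 0 := by
  rw [laplacian, hessian_of_fderiv_eq_zero GB hmax.fderiv_eq_zero]
  exact metricTrace_nonpos (hG.symm y hy) hpos (hmax.fderiv_fderiv_nonpos
    ((hu.contDiffAt (hG.isOpen.mem_nhds hy)).of_le (WithTop.coe_le_coe.2 le_top)))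

lemma laplacian_nonneg_of_isLocalMin (hG : IsMetricOn GB s) {y : E} (hy : y ∈ s)
    (hpos : ∀ v, v ≠ 0 → 0 < GB y v v) (hu : ContDiffOn ℝ ∞ u s) (hmin : IsLocalMin u y) :
    0 ≤ laplacian GB u y := by
  have := laplacian_nonpos_of_isLocalMax hG hy hpos hu.neg hmin.neg
  rw [laplacian_neg] at this
  linarith

/-- The trace over the base of the Einstein equation of a base conformal warped product with
scalar-flat base, at a critical point of the warping function. -/
lemma laplacian_eq_of_ricci_bcwp_base (hB : IsMetricOn GB s) (hF : IsMetricOn GF s')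
    (hu : ContDiffOn ℝ ∞ u s) {p : E × E'} (hp : p ∈ s ×ˢ s') (h0 : fderiv ℝ u p.1 = 0)
    (hS : scalarCurvature GB p.1 = 0) {lam : ℝ}
    (hE : ∀ v w : E, ricci (bcwp μ u GB GF) p (v, 0) (w, 0)
      = lam * bcwp μ u GB GF p (v, 0) (w, 0)) :
    (2 * (Module.finrank ℝ E - 1) * μ + Module.finrank ℝ E') * laplacian GB u p.1
      = -(Module.finrank ℝ E * lam * Real.exp (2 * μ * u p.1)) := by
  set c : ℝ := Module.finrank ℝ E' + (Module.finrank ℝ E - 2) * μ with hc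
  have h1 : ∀ v w : E, ricci GB p.1 v w = (lam * Real.exp (2 * μ * u p.1)
      + μ * laplacian GB u p.1) * GB p.1 v w + c * hessian GB u p.1 v w := by
    intro v w
    have := hE v w
    rw [ricci_bcwp_base hB hF hu hp h0, bcwp_apply] at this
    simp only [map_zero, mul_zero, add_zero] at this
    linarith
  have h2 : ((ContinuousLinearMap.inverse (GB p.1) : (E →L[ℝ] ℝ) →ₗ[ℝ] E) ∘ₗ
      (LinearMap.toContinuousLinearMap : (E →ₗ[ℝ] ℝ) ≃ₗ[ℝ] (E →L[ℝ] ℝ)).toLinearMap ∘ₗ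
        ricci GB p.1) = (lam * Real.exp (2 * μ * u p.1) + μ * laplacian GB u p.1) • LinearMap.id
      + c • (((ContinuousLinearMap.inverse (GB p.1)).comp (hessian GB u p.1) : E →L[ℝ] E) :
        E →ₗ[ℝ] E) := by
    refine LinearMap.ext fun v => ?_
    have h3 : LinearMap.toContinuousLinearMap (ricci GB p.1 v)
        = (lam * Real.exp (2 * μ * u p.1) + μ * laplacian GB u p.1) • GB p.1 v
          + c • hessian GB u p.1 v := by
      ext w
      simpa using h1 v w
    simp only [LinearMap.comp_apply, LinearEquiv.coe_coe, ContinuousLinearMap.coe_coe, h3, map_add,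
      map_smul, hB.inverse_apply hp.1, LinearMap.add_apply, LinearMap.smul_apply, LinearMap.id_apply,
      ContinuousLinearMap.comp_apply]
  -- The trace reads m(λe^{2μu} + μΔu) + (k + (m - 2)μ)Δu = 0, and mμ + k + (m - 2)μ = 2(m - 1)μ +
  -- k.
  rw [scalarCurvature, h2] at hS
  simp only [map_add, map_smul, LinearMap.trace_id, smul_eq_mul] at hS
  change _ + c * laplacian GB u p.1 = 0 at hS
  rw [hc] at hS
  linarith

end CoordMetric

open CoordMetric

/-! ### From charts to manifolds. -/

section ManifoldCharts

variable {E : Type*} [NormedAddCommGroup E] [NormedSpace ℝ E]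
  {H : Type*} [TopologicalSpace H] {I : ModelWithCorners ℝ E H}
  {M : Type*} [TopologicalSpace M] [ChartedSpace H M]
  {e : OpenPartialHomeomorph M H} {y : E}

lemma contMDiff_log {ψ : M → ℝ} (hψ : ContMDiff I 𝓘(ℝ) ∞ ψ) (hψ0 : ∀ b, 0 < ψ b) :
    ContMDiff I 𝓘(ℝ) ∞ fun b => Real.log (ψ b) := fun b =>
  ContDiffAt.comp_contMDiffAt (g := Real.log) (Real.contDiffAt_log.2 (hψ0 b).ne') (hψ b)

variable [IsManifold I ∞ M]

lemma contDiffOn_comp_extend_symm {f : M → ℝ} (hf : ContMDiff I 𝓘(ℝ) ∞ f) (he : e ∈ atlas H M) :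
    ContDiffOn ℝ ∞ (fun y => f ((e.extend I).symm y)) (e.extend I).target := by
  have h := contMDiffOn_extend_symm (I := I) (n := ∞) (IsManifold.subset_maximalAtlas he)
  rw [← e.extend_target'] at h
  exact contMDiffOn_iff_contDiffOn.1 (hf.comp_contMDiffOn h)

variable [I.Boundaryless]

lemma eq_zero_of_mfderiv_extend_symm (he : e ∈ atlas H M) (hy : y ∈ (e.extend I).target) {v : E}
    (hv : (mfderiv 𝓘(ℝ, E) I (e.extend I).symm y : E →L[ℝ] E) v = 0) : v = 0 := by
  have h1 := mdifferentiableAt_extend_symm (I := I) he hy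
  have hsrc : (e.extend I).symm y ∈ e.source := by
    rw [← e.extend_source (I := I)]; exact (e.extend I).map_target hy
  have h2 : MDifferentiableAt I 𝓘(ℝ, E) (e.extend I) ((e.extend I).symm y) :=
    (e.contMDiffAt_extend (n := ∞) (IsManifold.subset_maximalAtlas he) hsrc).mdifferentiableAt
      (by simp)
  have h3 := mfderiv_comp y h2 h1
  have h4 : (e.extend I) ∘ (e.extend I).symm =ᶠ[𝓝 y] id :=
    Filter.eventually_of_mem (e.isOpen_extend_target.mem_nhds hy)
      fun z hz => (e.extend I).right_inv hz
  rw [h4.mfderiv_eq, mfderiv_id] at h3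
  let A : E →L[ℝ] E := mfderiv I 𝓘(ℝ, E) (e.extend I) ((e.extend I).symm y)
  have h5 : v = A ((mfderiv 𝓘(ℝ, E) I (e.extend I).symm y : E →L[ℝ] E) v) :=
    DFunLike.congr_fun h3 v
  exact h5.trans ((congrArg A hv).trans (map_zero A))

lemma exists_mfderiv_extend_symm_eq [FiniteDimensional ℝ E] (he : e ∈ atlas H M)
    (hy : y ∈ (e.extend I).target) (w : E) :
    ∃ v : E, (mfderiv 𝓘(ℝ, E) I (e.extend I).symm y : E →L[ℝ] E) v = w := by
  let D : E →L[ℝ] E := mfderiv 𝓘(ℝ, E) I (e.extend I).symm y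
  have hinj : Function.Injective D.toLinearMap :=
    (injective_iff_map_eq_zero D.toLinearMap).2 fun v hv =>
      eq_zero_of_mfderiv_extend_symm he hy hv
  exact LinearMap.surjective_of_injective hinj w

lemma isMetricOn_coordExpression [FiniteDimensional ℝ E] (g : PseudoRiemannianMetric I M)
    (he : e ∈ atlas H M) : IsMetricOn (coordExpression I g.val e) (e.extend I).target where
  isOpen := e.isOpen_extend_target
  contDiffOn := g.smooth e he
  symm y _ v w := by
    rw [coordExpression_apply, coordExpression_apply]
    exact g.symm _ _ _
  nondegenerate y hy v hv := by
    refine eq_zero_of_mfderiv_extend_symm he hy (g.nondegenerate ((e.extend I).symm y) _ ?_)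
    intro w
    obtain ⟨w', hw'⟩ := exists_mfderiv_extend_symm_eq (I := I) he hy w
    have h1 := hv w'
    rw [coordExpression_apply] at h1
    rw [← hw']
    exact h1

lemma coordExpression_pos {g : PseudoRiemannianMetric I M} (hg : g.IsRiemannian)
    (he : e ∈ atlas H M) (hy : y ∈ (e.extend I).target) (v : E) (hv : v ≠ 0) :
    0 < coordExpression I g.val e y v v := by
  rw [coordExpression_apply]
  exact hg _ _ fun h0 => hv (eq_zero_of_mfderiv_extend_symm he hy h0)

variable {E' : Type*} [NormedAddCommGroup E'] [NormedSpace ℝ E']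
  {H' : Type*} [TopologicalSpace H'] {J : ModelWithCorners ℝ E' H'} [J.Boundaryless]
  {N : Type*} [TopologicalSpace N] [ChartedSpace H' N] [IsManifold J ∞ N]
  {e' : OpenPartialHomeomorph N H'}

lemma coordExpression_specialBcwp (gB : PseudoRiemannianMetric I M)
    (gF : PseudoRiemannianMetric J N) {ψ : M → ℝ} (hψ : ContMDiff I 𝓘(ℝ) ∞ ψ)
    (hψ0 : ∀ b, 0 < ψ b) (μ : ℝ) (he : e ∈ atlas H M) (he' : e' ∈ atlas H' N) {p : E × E'}
    (hp : p ∈ (e.extend I).target ×ˢ (e'.extend J).target) :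
    coordExpression (I.prod J) (specialBcwp gB gF ψ hψ hψ0 μ).val (e.prod e') p =
      bcwp μ (fun y => Real.log (ψ ((e.extend I).symm y))) (coordExpression I gB.val e)
        (coordExpression J gF.val e') p := by
  refine (coordExpression_bcwpForm gB gF (fun b => ψ b ^ μ) ψ he he' hp).trans ?_
  have h1 := hψ0 ((e.extend I).symm p.1)
  have h2 : (ψ ((e.extend I).symm p.1) ^ μ) ^ 2
      = Real.exp (2 * μ * Real.log (ψ ((e.extend I).symm p.1))) := by
    rw [Real.rpow_def_of_pos h1, ← Real.exp_nat_mul]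
    congr 1; push_cast; ring
  have h3 : ψ ((e.extend I).symm p.1) ^ 2
      = Real.exp (2 * Real.log (ψ ((e.extend I).symm p.1))) := by
    rw [two_mul, Real.exp_add, Real.exp_log h1, sq]
  rw [bcwp, ← h2, ← h3]

/-- The charts in the atlas of the product are exactly products of charts, and in those the metric
is the explicit `bcwp` with u = log ψ. -/
lemma isEinstein_specialBcwp_iff (gB : PseudoRiemannianMetric I M)
    (gF : PseudoRiemannianMetric J N) {ψ : M → ℝ} (hψ : ContMDiff I 𝓘(ℝ) ∞ ψ)
    (hψ0 : ∀ b, 0 < ψ b) (μ lam : ℝ) :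
    (specialBcwp gB gF ψ hψ hψ0 μ).IsEinstein (fun _ => lam) ↔
      ∀ e ∈ atlas H M, ∀ e' ∈ atlas H' N,
        ∀ p ∈ (e.extend I).target ×ˢ (e'.extend J).target, ∀ v w : E × E',
        ricci (bcwp μ (fun y => Real.log (ψ ((e.extend I).symm y))) (coordExpression I gB.val e)
          (coordExpression J gF.val e')) p v w
        = lam * bcwp μ (fun y => Real.log (ψ ((e.extend I).symm y))) (coordExpression I gB.val e)
          (coordExpression J gF.val e') p v w := by
  have ht : ∀ (e : OpenPartialHomeomorph M H) (e' : OpenPartialHomeomorph N H'),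
      ((e.prod e').extend (I.prod J)).target = (e.extend I).target ×ˢ (e'.extend J).target := by
    intro e e'; rw [e.extend_prod e']; rfl
  have hr : ∀ e ∈ atlas H M, ∀ e' ∈ atlas H' N,
      ∀ p ∈ (e.extend I).target ×ˢ (e'.extend J).target,
      ricci (coordExpression (I.prod J) (specialBcwp gB gF ψ hψ hψ0 μ).val (e.prod e')) p
      = ricci (bcwp μ (fun y => Real.log (ψ ((e.extend I).symm y))) (coordExpression I gB.val e)
          (coordExpression J gF.val e')) p := fun e he e' he' p hp =>
    ricci_congr (Filter.eventually_of_mem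
      ((e.isOpen_extend_target.prod e'.isOpen_extend_target).mem_nhds hp)
        fun q hq => coordExpression_specialBcwp gB gF hψ hψ0 μ he he' hq)
  constructor
  · rintro ⟨-, h⟩ e he e' he' p hp v w
    have := h (e.prod e') ⟨e, he, e', he', rfl⟩ p (by rw [ht]; exact hp) v w
    rwa [hr e he e' he' p hp, coordExpression_specialBcwp gB gF hψ hψ0 μ he he' hp] at this
  · refine fun h => ⟨contMDiff_const, ?_⟩
    rintro _ ⟨e, he, e', he', rfl⟩ p hp v w
    rw [ht] at hp
    have := h e he e' he' p hp v w
    rwa [← hr e he e' he' p hp, ← coordExpression_specialBcwp gB gF hψ hψ0 μ he he' hp] at this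

end ManifoldCharts

open CoordMetric

/-! ### The Einstein equation over a compact base. -/

section EinsteinBcwp

variable {E : Type*} [NormedAddCommGroup E] [InnerProductSpace ℝ E] [FiniteDimensional ℝ E]
  {H : Type*} [TopologicalSpace H] {I : ModelWithCorners ℝ E H} [I.Boundaryless]
  {M : Type*} [TopologicalSpace M] [ChartedSpace H M] [IsManifold I ∞ M]
  {E' : Type*} [NormedAddCommGroup E'] [NormedSpace ℝ E'] [FiniteDimensional ℝ E']
  {H' : Type*} [TopologicalSpace H'] {J : ModelWithCorners ℝ E' H'} [J.Boundaryless]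
  {N : Type*} [TopologicalSpace N] [ChartedSpace H' N] [IsManifold J ∞ N]
  {gB : PseudoRiemannianMetric I M} {gF : PseudoRiemannianMetric J N} {ψ : M → ℝ}
  {μ lam : ℝ}

/-- Constant rescalings of the factors do not change their Ricci tensors, so the equation says that
Ric_B ⊕ Ric_F = 0. Testing on vectors tangent to one factor, over any point of the other, separates
the two. -/
lemma isEinstein_specialBcwp_of_const (hψ : ContMDiff I 𝓘(ℝ) ∞ ψ) (hψ0 : ∀ b, 0 < ψ b) {a : ℝ}
    (ha : ∀ b, ψ b = a) [Nonempty M] [Nonempty N] :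
    (specialBcwp gB gF ψ hψ hψ0 μ).IsEinstein (fun _ => 0) ↔
      gF.IsEinstein (fun _ => 0) ∧ gB.IsRicciFlat := by
  rw [isEinstein_specialBcwp_iff]
  have hricci : ∀ e ∈ atlas H M, ∀ e' ∈ atlas H' N,
      ∀ p ∈ (e.extend I).target ×ˢ (e'.extend J).target, ∀ v w : E × E',
      ricci (bcwp μ (fun y => Real.log (ψ ((e.extend I).symm y))) (coordExpression I gB.val e)
          (coordExpression J gF.val e')) p v w
        = ricci (coordExpression I gB.val e) p.1 v.1 w.1
          + ricci (coordExpression J gF.val e') p.2 v.2 w.2 := by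
    intro e he e' he' p hp v w
    refine ricci_bcwp_of_fderiv_eq_zero (isMetricOn_coordExpression gB he)
      (isMetricOn_coordExpression gF he')
      (contDiffOn_comp_extend_symm (contMDiff_log hψ hψ0) he) hp ?_ ?_ v w <;> simp [ha]
  constructor
  · intro h
    constructor
    · refine ⟨contMDiff_const, fun e' he' q hq v w => ?_⟩
      obtain ⟨b⟩ := ‹Nonempty M›
      have hp : ((chartAt H b).extend I b, q) ∈
          ((chartAt H b).extend I).target ×ˢ (e'.extend J).target :=
        ⟨mem_extChartAt_target b, hq⟩
      have h1 := h _ (chart_mem_atlas H b) e' he' _ hp (0, v) (0, w)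
      rw [hricci _ (chart_mem_atlas H b) e' he' _ hp] at h1
      simpa using h1
    · intro e he y hy v w
      obtain ⟨f⟩ := ‹Nonempty N›
      have hp : (y, (chartAt H' f).extend J f) ∈
          (e.extend I).target ×ˢ ((chartAt H' f).extend J).target :=
        ⟨hy, mem_extChartAt_target f⟩
      have h1 := h e he _ (chart_mem_atlas H' f) _ hp (v, 0) (w, 0)
      rw [hricci e he _ (chart_mem_atlas H' f) _ hp] at h1
      simpa using h1
  · rintro ⟨⟨-, hF⟩, hB⟩ e he e' he' p hp v w
    rw [hricci e he e' he' p hp, hB e he _ hp.1, hF e' he' _ hp.2]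
    ring

/-- If a function on a connected manifold attains its maximum and satisfies `Δu + γ |∇u|² = 0`
in every chart, then it is constant. -/
lemma eq_of_forall_laplacian_add_eq_zero [PreconnectedSpace M] (hgB : gB.IsRiemannian) {u : M → ℝ}
    (hu : ContMDiff I 𝓘(ℝ) ∞ u) {γ : ℝ}
    (hL : ∀ e ∈ atlas H M, ∀ y ∈ (e.extend I).target,
      laplacian (coordExpression I gB.val e) (fun y => u ((e.extend I).symm y)) y
        + γ * fderiv ℝ (fun y => u ((e.extend I).symm y)) y
          (gradient (coordExpression I gB.val e) (fun y => u ((e.extend I).symm y)) y) = 0)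
    {b₀ : M} (hmax : ∀ b, u b ≤ u b₀) (b : M) : u b = u b₀ := by
  have hclosed : IsClosed {b | u b = u b₀} := isClosed_eq hu.continuous continuous_const
  -- At each point of the maximum set, the local strong maximum principle in the chart there gives a
  -- whole neighbourhood.
  have hopen : IsOpen {b | u b = u b₀} := by
    rw [isOpen_iff_mem_nhds]
    intro c hc
    have hatlas := chart_mem_atlas H c
    have h1 := eventually_eq_of_laplacian_add_eq_zero (isMetricOn_coordExpression gB hatlas)
      (fun y hy => coordExpression_pos hgB hatlas hy) (contDiffOn_comp_extend_symm hu hatlas)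
      (hL _ hatlas) (fun y _ => hmax _) (mem_extChartAt_target (I := I) c)
      ((congrArg u (extChartAt_to_inv (I := I) c)).trans hc)
    have h2 := (continuousAt_extChartAt (I := I) c).eventually h1
    filter_upwards [h2, extChartAt_source_mem_nhds (I := I) c] with z hz hzs
    exact (congrArg u ((extChartAt I c).left_inv hzs)).symm.trans hz
  have huniv := IsClopen.eq_univ ⟨hclosed, hopen⟩ ⟨b₀, rfl⟩
  exact Set.eq_univ_iff_forall.1 huniv b

lemma ricci_fiber_of_isEinstein (hψ : ContMDiff I 𝓘(ℝ) ∞ ψ) (hψ0 : ∀ b, 0 < ψ b)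
    (hE : (specialBcwp gB gF ψ hψ hψ0 μ).IsEinstein fun _ => lam)
    {e : OpenPartialHomeomorph M H} (he : e ∈ atlas H M) {e' : OpenPartialHomeomorph N H'}
    (he' : e' ∈ atlas H' N) {y : E} (hy : y ∈ (e.extend I).target) {q : E'}
    (hq : q ∈ (e'.extend J).target) (v w : E') {u : E → ℝ}
    (hu : u = fun y => Real.log (ψ ((e.extend I).symm y))) :
    ricci (coordExpression J gF.val e') q v w =
      (lam * Real.exp (2 * u y) + Real.exp (2 * (1 - μ) * u y)
        * (laplacian (coordExpression I gB.val e) u y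
          + (Module.finrank ℝ E' + (Module.finrank ℝ E - 2) * μ)
            * fderiv ℝ u y (gradient (coordExpression I gB.val e) u y)))
        * coordExpression J gF.val e' q v w := by
  subst hu
  have hp : (y, q) ∈ (e.extend I).target ×ˢ (e'.extend J).target := ⟨hy, hq⟩
  have h1 := (isEinstein_specialBcwp_iff gB gF hψ hψ0 μ lam).1 hE e he e' he' (y, q) hp
    (0, v) (0, w)
  rw [ricci_bcwp_fiber (isMetricOn_coordExpression gB he) (isMetricOn_coordExpression gF he')
    (contDiffOn_comp_extend_symm (contMDiff_log hψ hψ0) he) hp, bcwp_apply] at h1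
  simp only [map_zero, mul_zero, zero_add] at h1
  linarith

/-- An Einstein base conformal warped product over a compact scalar-flat Riemannian base has
Einstein constant zero and constant warping function. -/
lemma eq_zero_and_const_of_isEinstein [CompactSpace M] [ConnectedSpace M] [Nonempty N]
    [Nontrivial E] [Nontrivial E'] (hgB : gB.IsRiemannian) (hS : gB.IsScalarFlat)
    (hψ : ContMDiff I 𝓘(ℝ) ∞ ψ) (hψ0 : ∀ b, 0 < ψ b)
    (hE : (specialBcwp gB gF ψ hψ hψ0 μ).IsEinstein fun _ => lam) :
    lam = 0 ∧ ∃ a : ℝ, 0 < a ∧ ∀ b, ψ b = a := by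
  set u : M → ℝ := fun b => Real.log (ψ b) with hu
  have hsm : ContMDiff I 𝓘(ℝ) ∞ u := contMDiff_log hψ hψ0
  obtain ⟨f⟩ := ‹Nonempty N›
  have hf := chart_mem_atlas H' f
  set q := (chartAt H' f).extend J f with hq
  have hqt : q ∈ ((chartAt H' f).extend J).target := mem_extChartAt_target f
  -- One fibre point and one such pair suffice: their Ricci-to-metric quotient ν is a number that
  -- the fibre equation ties to every point of the base.
  obtain ⟨v, w, hvw⟩ : ∃ v w, coordExpression J gF.val (chartAt H' f) q v w ≠ 0 := by
    by_contra! hcon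
    obtain ⟨v, hv⟩ := exists_ne (0 : E')
    exact hv ((isMetricOn_coordExpression gF hf).nondegenerate q hqt v (hcon v))
  set ν : ℝ := ricci (coordExpression J gF.val (chartAt H' f)) q v w
    / coordExpression J gF.val (chartAt H' f) q v w with hν
  set γ : ℝ := Module.finrank ℝ E' + (Module.finrank ℝ E - 2) * μ with hγ
  have hfib : ∀ e ∈ atlas H M, ∀ y ∈ (e.extend I).target,
      ν = lam * Real.exp (2 * u ((e.extend I).symm y))
        + Real.exp (2 * (1 - μ) * u ((e.extend I).symm y))
        * (laplacian (coordExpression I gB.val e) (fun y => u ((e.extend I).symm y)) y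
          + γ * fderiv ℝ (fun y => u ((e.extend I).symm y)) y
            (gradient (coordExpression I gB.val e) (fun y => u ((e.extend I).symm y)) y)) := by
    intro e he y hy
    rw [hν, div_eq_iff hvw]
    exact ricci_fiber_of_isEinstein hψ hψ0 hE he hf hy hqt v w rfl
  have hbase : ∀ b : M,
      fderiv ℝ (fun y => u (((chartAt H b).extend I).symm y)) ((chartAt H b).extend I b) = 0 →
      (2 * (Module.finrank ℝ E - 1) * μ + Module.finrank ℝ E')
        * laplacian (coordExpression I gB.val (chartAt H b))
            (fun y => u (((chartAt H b).extend I).symm y)) ((chartAt H b).extend I b)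
        = -(Module.finrank ℝ E * lam * Real.exp
          (2 * μ * u (((chartAt H b).extend I).symm ((chartAt H b).extend I b)))) := by
    intro b hb
    have hbt : (chartAt H b).extend I b ∈ ((chartAt H b).extend I).target :=
      mem_extChartAt_target b
    have hba := chart_mem_atlas H b
    have hp : ((chartAt H b).extend I b, q) ∈
      ((chartAt H b).extend I).target ×ˢ ((chartAt H' f).extend J).target := ⟨hbt, hqt⟩
    exact laplacian_eq_of_ricci_bcwp_base (isMetricOn_coordExpression gB hba)
      (isMetricOn_coordExpression gF hf) (contDiffOn_comp_extend_symm hsm hba) hp hb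
      (hS _ hba _ hbt) fun v w =>
        (isEinstein_specialBcwp_iff gB gF hψ hψ0 μ lam).1 hE _ hba _ hf _ hp (v, 0) (w, 0)
  obtain ⟨b₁, -, hb₁⟩ := isCompact_univ.exists_isMaxOn Set.univ_nonempty hsm.continuous.continuousOn
  obtain ⟨b₂, -, hb₂⟩ := isCompact_univ.exists_isMinOn Set.univ_nonempty hsm.continuous.continuousOn
  have hmax : ∀ b, u b ≤ u b₁ := fun b => hb₁ (Set.mem_univ b)
  have hmin : ∀ b, u b₂ ≤ u b := fun b => hb₂ (Set.mem_univ b)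
  have hinv : ∀ b, u (((chartAt H b).extend I).symm ((chartAt H b).extend I b)) = u b :=
    fun b => congrArg u (extChartAt_to_inv (I := I) b)
  have hloc₁ : IsLocalMax (fun y => u (((chartAt H b₁).extend I).symm y))
      ((chartAt H b₁).extend I b₁) :=
    Filter.Eventually.of_forall fun y => (hmax _).trans_eq (hinv b₁).symm
  have hloc₂ : IsLocalMin (fun y => u (((chartAt H b₂).extend I).symm y))
      ((chartAt H b₂).extend I b₂) :=
    Filter.Eventually.of_forall fun y => (hinv b₂).trans_le (hmin _)
  have hΔ₁ := laplacian_nonpos_of_isLocalMax (isMetricOn_coordExpression gB (chart_mem_atlas H b₁))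
    (mem_extChartAt_target (I := I) b₁)
    (coordExpression_pos hgB (chart_mem_atlas H b₁) (mem_extChartAt_target (I := I) b₁))
    (contDiffOn_comp_extend_symm hsm (chart_mem_atlas H b₁)) hloc₁
  have hΔ₂ := laplacian_nonneg_of_isLocalMin (isMetricOn_coordExpression gB (chart_mem_atlas H b₂))
    (mem_extChartAt_target (I := I) b₂)
    (coordExpression_pos hgB (chart_mem_atlas H b₂) (mem_extChartAt_target (I := I) b₂))
    (contDiffOn_comp_extend_symm hsm (chart_mem_atlas H b₂)) hloc₂
  have hE₁ := hbase b₁ hloc₁.fderiv_eq_zero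
  have hE₂ := hbase b₂ hloc₂.fderiv_eq_zero
  have hF₁ := hfib _ (chart_mem_atlas H b₁) _ (mem_extChartAt_target (I := I) b₁)
  have hF₂ := hfib _ (chart_mem_atlas H b₂) _ (mem_extChartAt_target (I := I) b₂)
  simp only [extChartAt] at hΔ₁ hΔ₂ hF₁ hF₂
  rw [hloc₁.fderiv_eq_zero] at hF₁
  rw [hloc₂.fderiv_eq_zero] at hF₂
  have hm : (0 : ℝ) < Module.finrank ℝ E := by exact_mod_cast Module.finrank_pos
  -- The product of the base identities at maximum and minimum: a square times Δu(b₁) Δu(b₂) ≤ 0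
  -- would equal (mλ)² times positive exponentials.
  have hlam : lam = 0 := by
    by_contra hne
    have h1 := mul_nonneg (sq_nonneg (2 * (Module.finrank ℝ E - 1) * μ + Module.finrank ℝ E' : ℝ))
      (mul_nonneg (neg_nonneg.2 hΔ₁) hΔ₂)
    have h2 := congrArg₂ (· * ·) hE₁ hE₂
    have h3 : 0 < (Module.finrank ℝ E * lam) ^ 2 := by positivity
    have h4 := mul_pos (mul_pos h3 (Real.exp_pos
      (2 * μ * u (((chartAt H b₁).extend I).symm ((chartAt H b₁).extend I b₁))))) (Real.exp_pos
      (2 * μ * u (((chartAt H b₂).extend I).symm ((chartAt H b₂).extend I b₂))))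
    linarith
  refine ⟨hlam, ?_⟩
  -- With λ = 0 and du = 0 at the extrema, ν is a positive multiple of Δu at each of them.
  have hν0 : ν = 0 := by
    refine le_antisymm ?_ ?_
    · rw [hF₁, hlam]
      simpa using mul_nonpos_of_nonneg_of_nonpos (Real.exp_pos _).le hΔ₁
    · rw [hF₂, hlam]
      simpa using mul_nonneg (Real.exp_pos _).le hΔ₂
  have hconst := eq_of_forall_laplacian_add_eq_zero hgB hsm (γ := γ) (fun e he y hy => by
    have h1 := hfib e he y hy
    rw [hν0, hlam, zero_mul, zero_add] at h1
    exact (mul_eq_zero.1 h1.symm).resolve_left (Real.exp_pos _).ne') hmax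
  exact ⟨ψ b₁, hψ0 b₁, fun b => Real.log_injOn_pos (hψ0 b) (hψ0 b₁) (hconst b)⟩

end EinsteinBcwp

end

theorem mainTheorem12 (m k : ℕ) (hm : 1 ≤ m) (hk : 1 ≤ k)
    {B : Type*} [TopologicalSpace B] [ChartedSpace (EuclideanSpace ℝ (Fin m)) B]
    [IsManifold (𝓡 m) ∞ B] [T2Space B] [CompactSpace B] [ConnectedSpace B]
    {F : Type*} [TopologicalSpace F] [ChartedSpace (EuclideanSpace ℝ (Fin k)) F]
    [IsManifold (𝓡 k) ∞ F] [T2Space F] [SecondCountableTopology F] [ConnectedSpace F]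
    (gB : PseudoRiemannianMetric (𝓡 m) B) (hgB : gB.IsRiemannian) (hS : gB.IsScalarFlat)
    (gF : PseudoRiemannianMetric (𝓡 k) F)
    (ψ : B → ℝ) (hψ : ContMDiff (𝓡 m) 𝓘(ℝ) ∞ ψ) (hψ0 : ∀ b, 0 < ψ b)
    (μ lam : ℝ) :
    (specialBcwp gB gF ψ hψ hψ0 μ).IsEinstein (fun _ => lam) ↔
      gF.IsEinstein (fun _ => 0) ∧ lam = 0 ∧ (∃ a : ℝ, 0 < a ∧ ∀ b, ψ b = a) ∧
        gB.IsRicciFlat := by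
  -- Positive dimensions make the model spaces nontrivial: m > 0 is used to get λ = 0, and k > 0 to
  -- find a nonzero value of g_F.
  have : Nonempty (Fin m) := ⟨⟨0, hm⟩⟩
  have : Nonempty (Fin k) := ⟨⟨0, hk⟩⟩
  constructor
  · intro hE
    obtain ⟨rfl, a, ha, hψa⟩ := eq_zero_and_const_of_isEinstein hgB hS hψ hψ0 hE
    obtain ⟨hF, hB⟩ := (isEinstein_specialBcwp_of_const hψ hψ0 hψa).1 hE
    exact ⟨hF, rfl, ⟨a, ha, hψa⟩, hB⟩
  · rintro ⟨hF, rfl, ⟨a, -, hψa⟩, hB⟩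
    exact (isEinstein_specialBcwp_of_const hψ hψ0 hψa).2 ⟨hF, hB⟩
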